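/- Let $(\mathcal{M},\otimes,\mathbf{1},c)$ be a braided monoidal category whose underlying category is abelian, complete, cocomplete and satisfies $AB5$. Assume that for every object $X$ the functors $X\otimes -$ and $-\otimes X$ are additive, left exact and right exact and commute with direct sums. Let $i:B\hookrightarrow E$ be a monomorphism in $\mathcal{M}$ which is a homomorphism of bialgebras in $(\mathcal{M},c)$. For subobjects $C,D$ of $E$ put $C\wedge_E D=\ker\big((p_C\otimes p_D)\circ\Delta_E\big)$, where $p_C:E\to E/C$ and $p_D:E\to E/D$ are the projections, and let $B^{\wedge_E 0}=0$ and $B^{\wedge_E n+1}=B^{\wedge_E n}\wedge_E B$ for $n\ge 0$. Then $B^{\wedge_E a}\subseteq B^{\wedge_E b}$ for $a\le b$, and $B^{\wedge_E 1}=B$. Assume that the canonical injection $B^{\wedge_E a}\to B^{\wedge_E b}$ is a split monomorphism in $\mathcal{M}$ for all $a\le b$. Let $gr^n=B^{\wedge_E n+1}/B^{\wedge_E n}$, with projection $\pi_n:B^{\wedge_E n+1}\to gr^n$ and canonical monomorphism $\iota_n:gr^n\to E/B^{\wedge_E n}$, and let $gr_BE=\bigoplus_{n\in\mathbb{N}}gr^n$,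 with injections $j_n:gr^n\to gr_BE$. The associated graded coalgebra is $gr_BE$ with the comultiplication $\Delta$ given by $\Delta\circ j_n=\sum_{a+b=n}(j_a\otimes j_b)\circ\Delta_{a,b}$, where $\Delta_{a,b}:gr^{a+b}\to gr^a\otimes gr^b$ is the unique morphism such that $(\iota_a\otimes\iota_b)\circ\Delta_{a,b}=\overline{\Delta}_{a,b}\circ\iota_{a+b}$ and $\overline{\Delta}_{a,b}:E/B^{\wedge_E a+b}\to E/B^{\wedge_E a}\otimes E/B^{\wedge_E b}$ is induced by $\Delta_E$, and with the counit $\varepsilon$ that is induced by $\varepsilon_E$ on $gr^0=B$ and is zero on $gr^n$ for $n>0$. Then, for all $a,b\in\mathbb{N}$, the multiplication $m_E$ of $E$ restricts to a morphism $m_\wedge^{a,b}:B^{\wedge_E a+1}\otimes B^{\wedge_E b+1}\to B^{\wedge_E a+b+1}$. Moreover there is exactly one bialgebra structure in $(\mathcal{M},c)$ on $gr_BE$ that is graded (its multiplication and its comultiplication are graded homomorphisms), whose underlying coalgebra is the associated graded coalgebra, whose unit is $j_0\circ\pi_0\circ u_B$, and whose multiplication $m$ is induced by that of $E$, that is, satisfies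 $$m\circ\big(j_a\pi_a\otimes j_b\pi_b\big)=j_{a+b}\circ\pi_{a+b}\circ m_\wedge^{a,b}\qquad\text{for all }a,b\in\mathbb{N}.$$ In particular $gr_BE$ is a graded braided bialgebra. -/

import Mathlib

open CategoryTheory CategoryTheory.Limits CategoryTheory.MonoidalCategory
open scoped MonObj ComonObj

universe v u

/-! ### Abelian and coabelian monoidal categories -/

section MonoidalCategories

variable (M : Type u) [Category.{v} M] [Abelian M] [MonoidalCategory M]

/-- An abelian monoidal category: the category is abelian and all the functors `X ⊗ -` and `- ⊗ X`
are additive (this is `MonoidalPreadditive`) and right exact. -/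
class AbelianMonoidal : Prop extends MonoidalPreadditive M where
  rightExact_tensorLeft (X : M) : PreservesFiniteColimits (tensorLeft X)
  rightExact_tensorRight (X : M) : PreservesFiniteColimits (tensorRight X)

/-- A coabelian monoidal category (the opposite monoidal category is abelian monoidal): the
category is abelian and all the functors `X ⊗ -` and `- ⊗ X` are additive and left exact. -/
class CoabelianMonoidal : Prop extends MonoidalPreadditive M where
  leftExact_tensorLeft (X : M) : PreservesFiniteLimits (tensorLeft X)
  leftExact_tensorRight (X : M) : PreservesFiniteLimits (tensorRight X)

/-- The tensor product commutes with (arbitrary small) direct sums, in each variable. -/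
class TensorCommutesWithDirectSums : Prop where
  preserves_tensorLeft (J : Type v) (X : M) : PreservesColimitsOfShape (Discrete J) (tensorLeft X)
  preserves_tensorRight (J : Type v) (X : M) : PreservesColimitsOfShape (Discrete J) (tensorRight X)

attribute [instance] AbelianMonoidal.rightExact_tensorLeft AbelianMonoidal.rightExact_tensorRight
  CoabelianMonoidal.leftExact_tensorLeft CoabelianMonoidal.leftExact_tensorRight
  TensorCommutesWithDirectSums.preserves_tensorLeft
  TensorCommutesWithDirectSums.preserves_tensorRight

end MonoidalCategories

/-! ### Graded objects, graded algebras, graded coalgebras, graded braided bialgebras -/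

noncomputable section Graded

variable {M : Type u} [Category.{v} M] [Abelian M] [HasColimits M] [MonoidalCategory M]

/-- The degree `n` component `⨁_{a+b=n} X_a ⊗ Y_b` of the tensor product of two graded objects. -/
def tensorDeg (X Y : ℕ → M) (n : ℕ) : M :=
  ∐ fun p : Finset.HasAntidiagonal.antidiagonal n => X p.1.1 ⊗ Y p.1.2

/-- The canonical morphism from the degree `n` component of `X ⊗ Y` to `(⨁ X) ⊗ (⨁ Y)`. -/
def tensorDegι (X Y : ℕ → M) (n : ℕ) : tensorDeg X Y n ⟶ (∐ X) ⊗ (∐ Y) :=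
  Sigma.desc fun p => Sigma.ι X p.1.1 ⊗ₘ Sigma.ι Y p.1.2

/-- `m : A ⊗ A ⟶ A` is a graded homomorphism, where `A = ⨁ A_n`. -/
def IsGradedMul (A : ℕ → M) (m : (∐ A) ⊗ (∐ A) ⟶ ∐ A) : Prop :=
  ∃ mdeg : ∀ n, tensorDeg A A n ⟶ A n, ∀ n, tensorDegι A A n ≫ m = mdeg n ≫ Sigma.ι A n

/-- `d : C ⟶ C ⊗ C` is a graded homomorphism, where `C = ⨁ C_n`. -/
def IsGradedComul (C : ℕ → M) (d : ∐ C ⟶ (∐ C) ⊗ (∐ C)) : Prop :=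
  ∃ ddeg : ∀ n, C n ⟶ tensorDeg C C n, ∀ n, Sigma.ι C n ≫ d = ddeg n ≫ tensorDegι C C n

/-- A braided bialgebra structure on `⨁ X_n` is graded if `⨁ X_n` is both a graded algebra and a
graded coalgebra with respect to the given graduation. -/
structure IsGradedBialgebra [BraidedCategory M] (X : ℕ → M) (S : BimonObj (∐ X)) : Prop where
  mul : IsGradedMul X S.mul
  comul : IsGradedComul X S.comul

end Graded

/-! ### Quotients of subobjects -/

noncomputable section Quotients

variable {M : Type u} [Category.{v} M] [Abelian M] {E : M}

/-- The quotient `Y / X` of two subobjects `X ≤ Y` of `E`. -/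
def subQuot (X Y : Subobject E) (h : X ≤ Y) : M := cokernel (Subobject.ofLE X Y h)

/-- The projection `Y ⟶ Y / X`. -/
def subQuotπ (X Y : Subobject E) (h : X ≤ Y) : (Y : M) ⟶ subQuot X Y h :=
  cokernel.π (Subobject.ofLE X Y h)

instance (X Y : Subobject E) (h : X ≤ Y) : Epi (subQuotπ X Y h) :=
  inferInstanceAs (Epi (cokernel.π (Subobject.ofLE X Y h)))

/-- The canonical morphism `Y / X ⟶ E / X`. -/
def subQuotι (X Y : Subobject E) (h : X ≤ Y) : subQuot X Y h ⟶ cokernel X.arrow :=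
  cokernel.desc _ (Y.arrow ≫ cokernel.π X.arrow) (by
    rw [← Category.assoc, Subobject.ofLE_arrow, cokernel.condition])

/-- The canonical morphism `E / X ⟶ E / Y`. -/
def quotMap (X Y : Subobject E) (h : X ≤ Y) : cokernel X.arrow ⟶ cokernel Y.arrow :=
  cokernel.desc _ (cokernel.π Y.arrow) (by
    rw [← Subobject.ofLE_arrow h, Category.assoc, cokernel.condition, comp_zero])

@[simp]
lemma subQuotπ_ι (X Y : Subobject E) (h : X ≤ Y) :
    subQuotπ X Y h ≫ subQuotι X Y h = Y.arrow ≫ cokernel.π X.arrow :=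
  cokernel.π_desc _ _ _

@[simp]
lemma π_quotMap (X Y : Subobject E) (h : X ≤ Y) :
    cokernel.π X.arrow ≫ quotMap X Y h = cokernel.π Y.arrow :=
  cokernel.π_desc _ _ _

lemma subQuotι_quotMap (X Y : Subobject E) (h : X ≤ Y) : subQuotι X Y h ≫ quotMap X Y h = 0 := by
  rw [← cancel_epi (subQuotπ X Y h), comp_zero, ← Category.assoc, subQuotπ_ι, Category.assoc,
    π_quotMap, cokernel.condition]

/-- A morphism killed by the projection onto `E / X` factors through `X`. -/
lemma exists_lift_of_comp_π {T : M} (X : Subobject E) (e : T ⟶ E)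
    (he : e ≫ cokernel.π X.arrow = 0) : ∃ x : T ⟶ (X : M), x ≫ X.arrow = e :=
  ⟨Abelian.monoLift X.arrow e he, Abelian.monoLift_comp _ _ _⟩

instance (X Y : Subobject E) (h : X ≤ Y) : Mono (subQuotι X Y h) := by
  rw [Preadditive.mono_iff_cancel_zero]
  intro T t ht
  obtain ⟨T', q, hq, y, hy⟩ := surjective_up_to_refinements_of_epi (subQuotπ X Y h) t
  have h1 : (y ≫ Y.arrow) ≫ cokernel.π X.arrow = 0 := by
    rw [Category.assoc, ← subQuotπ_ι X Y h, ← Category.assoc, ← hy, Category.assoc, ht, comp_zero]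
  obtain ⟨x, hx⟩ := exists_lift_of_comp_π X _ h1
  have h2 : y = x ≫ Subobject.ofLE X Y h := by
    rw [← cancel_mono Y.arrow, Category.assoc, Subobject.ofLE_arrow, hx]
  rw [← cancel_epi q, hy, h2, comp_zero, Category.assoc]
  exact (congrArg (x ≫ ·) (cokernel.condition _)).trans comp_zero

/-- `Y / X ⟶ E / X ⟶ E / Y` is exact. -/
lemma subQuot_exact (X Y : Subobject E) (h : X ≤ Y) :
    (ShortComplex.mk _ _ (subQuotι_quotMap X Y h)).Exact := by
  rw [ShortComplex.exact_iff_exact_up_to_refinements]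
  intro T t ht
  obtain ⟨T', q, hq, e, he⟩ := surjective_up_to_refinements_of_epi (cokernel.π X.arrow) t
  have h1 : e ≫ cokernel.π Y.arrow = 0 := by
    rw [← π_quotMap X Y h, ← Category.assoc, ← he, Category.assoc]
    dsimp at ht
    rw [ht, comp_zero]
  obtain ⟨y, hy⟩ := exists_lift_of_comp_π Y _ h1
  refine ⟨T', q, hq, y ≫ subQuotπ X Y h, ?_⟩
  dsimp
  rw [he, Category.assoc, subQuotπ_ι, ← Category.assoc, hy]

end Quotients

/-! ### The wedge filtration -/

noncomputable section Wedge

variable {M : Type u} [Category.{v} M] [Abelian M] [MonoidalCategory M]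

/-- The morphism `(p_C ⊗ p_D) ∘ Δ : E ⟶ E / C ⊗ E / D`. -/
def wedgeMap {E : M} [ComonObj E] (C D : Subobject E) : E ⟶ cokernel C.arrow ⊗ cokernel D.arrow :=
  Δ[E] ≫ (cokernel.π C.arrow ⊗ₘ cokernel.π D.arrow)

/-- The wedge product `C ∧ D` of two subobjects of a coalgebra `E`. -/
def wedge {E : M} [ComonObj E] (C D : Subobject E) : Subobject E :=
  kernelSubobject (wedgeMap C D)

/-- The wedge powers of a subobject `i : B ⟶ E` of a coalgebra `E`: the zeroth one is `0`, and
the `(n+1)`-st one is the wedge product of the `n`-th one and `B`. -/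
def wedgePow {B E : M} [ComonObj E] (i : B ⟶ E) [Mono i] : ℕ → Subobject E
  | 0 => ⊥
  | n + 1 => wedge (wedgePow i n) (Subobject.mk i)

section

variable {E : M} [ComonObj E]

lemma wedgeMap_eq_quotMap {A A' D D' : Subobject E} (h : A ≤ A') (h' : D ≤ D') :
    wedgeMap A' D' = wedgeMap A D ≫ (quotMap A A' h ⊗ₘ quotMap D D' h') := by
  simp [wedgeMap]

lemma wedge_arrow_wedgeMap (A D : Subobject E) : (wedge A D).arrow ≫ wedgeMap A D = 0 :=
  kernelSubobject_arrow_comp _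

lemma wedge_lift {T : M} (A D : Subobject E) (e : T ⟶ E) (he : e ≫ wedgeMap A D = 0) :
    ∃ x : T ⟶ (wedge A D : M), x ≫ (wedge A D).arrow = e :=
  ⟨factorThruKernelSubobject _ e he, factorThruKernelSubobject_comp_arrow _ _ _⟩

/-- Coassociativity, after projecting to `E / A ⊗ (E / D ⊗ E / F)`. -/
lemma comul_wedgeMap_assoc (A D F : Subobject E) :
    Δ[E] ≫ (wedgeMap A D ⊗ₘ cokernel.π F.arrow) ≫ (α_ _ _ _).hom =
      Δ[E] ≫ (cokernel.π A.arrow ⊗ₘ wedgeMap D F) := by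
  have e1 : wedgeMap A D ⊗ₘ cokernel.π F.arrow =
      Δ[E] ▷ E ≫ ((cokernel.π A.arrow ⊗ₘ cokernel.π D.arrow) ⊗ₘ cokernel.π F.arrow) := by
    rw [wedgeMap, ← tensorHom_id, tensorHom_comp_tensorHom, Category.id_comp]
  have e2 : cokernel.π A.arrow ⊗ₘ wedgeMap D F =
      E ◁ Δ[E] ≫ (cokernel.π A.arrow ⊗ₘ (cokernel.π D.arrow ⊗ₘ cokernel.π F.arrow)) := by
    rw [wedgeMap, ← id_tensorHom, tensorHom_comp_tensorHom, Category.id_comp]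
  rw [e1, e2, Category.assoc, associator_naturality, ComonObj.comul_assoc_assoc]

end

variable [CoabelianMonoidal M]

instance mono_whiskerLeft (X : M) {Y Z : M} (f : Y ⟶ Z) [Mono f] : Mono (X ◁ f) :=
  inferInstanceAs (Mono ((tensorLeft X).map f))

instance mono_whiskerRight (X : M) {Y Z : M} (f : Y ⟶ Z) [Mono f] : Mono (f ▷ X) :=
  inferInstanceAs (Mono ((tensorRight X).map f))

instance mono_tensorHom {X Y Z W : M} (f : X ⟶ Y) (g : Z ⟶ W) [Mono f] [Mono g] :
    Mono (f ⊗ₘ g) := by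
  rw [MonoidalCategory.tensorHom_def]; infer_instance

section

variable {E : M} [ComonObj E]

lemma wedge_mono_left {A A' : Subobject E} (D : Subobject E) (h : A ≤ A') :
    wedge A D ≤ wedge A' D := by
  apply le_kernelSubobject
  rw [wedgeMap_eq_quotMap h le_rfl, ← Category.assoc, wedge_arrow_wedgeMap, zero_comp]

/-- The morphism `E / (A ∧ D) ⟶ E / A ⊗ E / D` induced by the comultiplication of `E`. -/
def wedgeBar (A D : Subobject E) :
    cokernel (wedge A D).arrow ⟶ cokernel A.arrow ⊗ cokernel D.arrow :=
  cokernel.desc _ (wedgeMap A D) (wedge_arrow_wedgeMap A D)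

lemma π_wedgeBar (A D : Subobject E) :
    cokernel.π (wedge A D).arrow ≫ wedgeBar A D = wedgeMap A D :=
  cokernel.π_desc _ _ _

instance (A D : Subobject E) : Mono (wedgeBar A D) := by
  rw [Preadditive.mono_iff_cancel_zero]
  intro T t ht
  obtain ⟨T', q, hq, e, he⟩ := surjective_up_to_refinements_of_epi
    (cokernel.π (wedge A D).arrow) t
  have h1 : e ≫ wedgeMap A D = 0 := by
    rw [← π_wedgeBar, ← Category.assoc, ← he, Category.assoc, ht, comp_zero]
  obtain ⟨x, hx⟩ := wedge_lift A D e h1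
  rw [← cancel_epi q, he, ← hx, comp_zero, Category.assoc, cokernel.condition, comp_zero]

lemma wedge_arrow_wedgeMap_bot (A D : Subobject E) (hD : D.arrow ≫ wedgeMap D ⊥ = 0) :
    (wedge A D).arrow ≫ wedgeMap (wedge A D) ⊥ = 0 := by
  obtain ⟨g, hg⟩ : ∃ g, cokernel.π D.arrow ≫ g = wedgeMap D ⊥ :=
    ⟨cokernel.desc _ _ hD, cokernel.π_desc _ _ _⟩
  have e : wedgeMap (wedge A D) ⊥ ≫ wedgeBar A D ▷ cokernel (⊥ : Subobject E).arrow ≫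
      (α_ _ _ _).hom = wedgeMap A D ≫ (_ ◁ g) := by
    rw [wedgeMap, Category.assoc, ← tensorHom_id, tensorHom_comp_tensorHom_assoc, π_wedgeBar,
      Category.comp_id, comul_wedgeMap_assoc, ← hg, wedgeMap, ← id_tensorHom, Category.assoc,
      tensorHom_comp_tensorHom, Category.comp_id]
  rw [← cancel_mono (wedgeBar A D ▷ cokernel (⊥ : Subobject E).arrow), ← cancel_mono (α_ _ _ _).hom,
    zero_comp, zero_comp, Category.assoc, Category.assoc, e, ← Category.assoc,
    wedge_arrow_wedgeMap, zero_comp]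

lemma wedge_arrow_wedgeMap_wedge (A A' F D : Subobject E) (h : F.arrow ≫ wedgeMap A A' = 0) :
    (wedge F D).arrow ≫ wedgeMap A (wedge A' D) = 0 := by
  obtain ⟨g, hg⟩ : ∃ g, cokernel.π F.arrow ≫ g = wedgeMap A A' :=
    ⟨cokernel.desc _ _ h, cokernel.π_desc _ _ _⟩
  have e : wedgeMap A (wedge A' D) ≫ cokernel A.arrow ◁ wedgeBar A' D =
      wedgeMap F D ≫ (g ▷ _) ≫ (α_ _ _ _).hom := by
    rw [wedgeMap, Category.assoc, ← id_tensorHom, tensorHom_comp_tensorHom, π_wedgeBar,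
      Category.comp_id, ← comul_wedgeMap_assoc, ← hg, wedgeMap, ← tensorHom_id, Category.assoc,
      tensorHom_comp_tensorHom_assoc, Category.comp_id]
  rw [← cancel_mono (cokernel A.arrow ◁ wedgeBar A' D), zero_comp, Category.assoc, e,
    ← Category.assoc, wedge_arrow_wedgeMap, zero_comp]

end

section

variable {B E : M} [ComonObj E] (i : B ⟶ E) [Mono i]

/-- The wedge powers form an increasing chain. -/
lemma wedgePow_mono : Monotone (wedgePow i) := by
  refine monotone_nat_of_le_succ fun n => ?_
  induction n with
  | zero => exact bot_le
  | succ n ih => exact wedge_mono_left _ ih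

/-- The canonical injection from the `a`-th to the `b`-th wedge power, for `a ≤ b`. -/
def wedgePowIncl {a b : ℕ} (h : a ≤ b) : (wedgePow i a : M) ⟶ (wedgePow i b : M) :=
  Subobject.ofLE _ _ (wedgePow_mono i h)

variable [ComonObj B] [IsComonHom i]

lemma comp_π_mk {B E : M} (i : B ⟶ E) [Mono i] : i ≫ cokernel.π (Subobject.mk i).arrow = 0 := by
  have h := cokernel.condition (Subobject.mk i).arrow
  rw [← cancel_epi (Subobject.underlyingIso i).inv, ← Category.assoc,
    Subobject.underlyingIso_arrow, comp_zero] at h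
  exact h

lemma mk_arrow_wedgeMap (D : Subobject E) :
    (Subobject.mk i).arrow ≫ wedgeMap (Subobject.mk i) D = 0 := by
  rw [← cancel_epi (Subobject.underlyingIso i).inv, ← Category.assoc,
    Subobject.underlyingIso_arrow, wedgeMap, IsComonHom.hom_comul_assoc, tensorHom_comp_tensorHom,
    comp_π_mk]
  simp

lemma mk_arrow_wedgeMap' (D : Subobject E) :
    (Subobject.mk i).arrow ≫ wedgeMap D (Subobject.mk i) = 0 := by
  rw [← cancel_epi (Subobject.underlyingIso i).inv, ← Category.assoc,
    Subobject.underlyingIso_arrow, wedgeMap, IsComonHom.hom_comul_assoc, tensorHom_comp_tensorHom,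
    comp_π_mk]
  simp

lemma wedgePow_arrow_wedgeMap_bot (a : ℕ) :
    (wedgePow i a).arrow ≫ wedgeMap (wedgePow i a) ⊥ = 0 := by
  cases a with
  | zero =>
    have h : (wedgePow i 0).arrow = 0 := Subobject.bot_arrow
    exact (congrArg (· ≫ wedgeMap (wedgePow i 0) ⊥) h).trans zero_comp
  | succ a => exact wedge_arrow_wedgeMap_bot _ _ (mk_arrow_wedgeMap i ⊥)

/-- The `(a+b)`-th wedge power is killed by `(p_a ⊗ p_b) ∘ Δ`, where `p_a`, `p_b` are the
projections modulo the `a`-th and the `b`-th wedge power. -/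
lemma wedgePow_arrow_wedgeMap (a b n : ℕ) (h : a + b = n) :
    (wedgePow i n).arrow ≫ wedgeMap (wedgePow i a) (wedgePow i b) = 0 := by
  subst h
  induction b with
  | zero => exact wedgePow_arrow_wedgeMap_bot i a
  | succ b ih => exact wedge_arrow_wedgeMap_wedge _ _ _ _ ih

end

end Wedge

/-! ### The associated graded coalgebra -/

noncomputable section AssocGraded

variable {M : Type u} [Category.{v} M] [Abelian M] [MonoidalCategory M] [CoabelianMonoidal M]
  {B E : M} [ComonObj E] (i : B ⟶ E) [Mono i]

/-- The degree `n` component of the associated graded object: the quotient of the `(n+1)`-st by the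
`n`-th wedge power. -/
def grDeg (n : ℕ) : M := subQuot (wedgePow i n) (wedgePow i (n + 1)) (wedgePow_mono i n.le_succ)

/-- The projection from the `(n+1)`-st wedge power to its quotient by the `n`-th one. -/
def grπ (n : ℕ) : (wedgePow i (n + 1) : M) ⟶ grDeg i n := subQuotπ _ _ (wedgePow_mono i n.le_succ)

/-- The quotient of `E` by the `n`-th wedge power. -/
abbrev quotPow (n : ℕ) : M := cokernel (wedgePow i n).arrow

/-- The canonical monomorphism from the degree `n` component of the associated graded object to
the quotient of `E` by the `n`-th wedge power. -/
def grι (n : ℕ) : grDeg i n ⟶ quotPow i n := subQuotι _ _ (wedgePow_mono i n.le_succ)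

instance (n : ℕ) : Epi (grπ i n) :=
  inferInstanceAs (Epi (subQuotπ _ _ (wedgePow_mono i n.le_succ)))

instance (n : ℕ) : Mono (grι i n) :=
  inferInstanceAs (Mono (subQuotι _ _ (wedgePow_mono i n.le_succ)))

lemma grπ_ι (n : ℕ) :
    grπ i n ≫ grι i n = (wedgePow i (n + 1)).arrow ≫ cokernel.π (wedgePow i n).arrow :=
  subQuotπ_ι _ _ _

/-- A morphism to `E / B^a ⊗ E / B^b` factors through the tensor product of the components of
degrees `a` and `b` if it vanishes in `E / B^(a+1) ⊗ E / B^b` and in `E / B^a ⊗ E / B^(b+1)`. -/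
lemma exists_lift_grι_tensor {T : M} (a b : ℕ) (f : T ⟶ quotPow i a ⊗ quotPow i b)
    (h1 : f ≫ (quotMap _ _ (wedgePow_mono i a.le_succ) ▷ quotPow i b) = 0)
    (h2 : f ≫ (quotPow i a ◁ quotMap _ _ (wedgePow_mono i b.le_succ)) = 0) :
    ∃ g : T ⟶ grDeg i a ⊗ grDeg i b, g ≫ (grι i a ⊗ₘ grι i b) = f := by
  have exb := (subQuot_exact _ _ (wedgePow_mono i b.le_succ)).map_of_mono_of_preservesKernel
    (tensorLeft (quotPow i a)) (inferInstanceAs (Mono (grι i b))) inferInstance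
  have exa := (subQuot_exact _ _ (wedgePow_mono i a.le_succ)).map_of_mono_of_preservesKernel
    (tensorRight (grDeg i b)) (inferInstanceAs (Mono (grι i a))) inferInstance
  obtain ⟨f', hf'⟩ : ∃ f' : T ⟶ quotPow i a ⊗ grDeg i b, f' ≫ quotPow i a ◁ grι i b = f :=
    haveI : Mono ((ShortComplex.mk _ _ (subQuotι_quotMap _ _
      (wedgePow_mono i b.le_succ))).map (tensorLeft (quotPow i a))).f :=
      inferInstanceAs (Mono (quotPow i a ◁ grι i b))
    ⟨exb.lift f h2, exb.lift_f f h2⟩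
  have h3 : f' ≫ (quotMap _ _ (wedgePow_mono i a.le_succ) ▷ grDeg i b) = 0 := by
    rw [← cancel_mono (_ ◁ grι i b), Category.assoc, ← whisker_exchange, ← Category.assoc, hf', h1,
      zero_comp]
  obtain ⟨g, hg⟩ : ∃ g : T ⟶ grDeg i a ⊗ grDeg i b, g ≫ grι i a ▷ grDeg i b = f' :=
    haveI : Mono ((ShortComplex.mk _ _ (subQuotι_quotMap _ _
      (wedgePow_mono i a.le_succ))).map (tensorRight (grDeg i b))).f :=
      inferInstanceAs (Mono (grι i a ▷ grDeg i b))
    ⟨exa.lift f' h3, exa.lift_f f' h3⟩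
  refine ⟨g, ?_⟩
  rw [MonoidalCategory.tensorHom_def, ← Category.assoc, hg, hf']

variable [ComonObj B] [IsComonHom i]

/-- The morphism `E / B^n ⟶ E / B^a ⊗ E / B^b`, for `a + b = n`, induced by the comultiplication
of `E` (powers are wedge powers). -/
def quotComul (a b n : ℕ) (h : a + b = n) : quotPow i n ⟶ quotPow i a ⊗ quotPow i b :=
  cokernel.desc _ (wedgeMap (wedgePow i a) (wedgePow i b)) (wedgePow_arrow_wedgeMap i a b n h)

lemma π_quotComul (a b n : ℕ) (h : a + b = n) :
    cokernel.π (wedgePow i n).arrow ≫ quotComul i a b n h =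
      wedgeMap (wedgePow i a) (wedgePow i b) :=
  cokernel.π_desc _ _ _

lemma exists_grComulDeg (a b n : ℕ) (h : a + b = n) :
    ∃ g : grDeg i n ⟶ grDeg i a ⊗ grDeg i b,
      g ≫ (grι i a ⊗ₘ grι i b) = grι i n ≫ quotComul i a b n h := by
  apply exists_lift_grι_tensor
  · rw [← cancel_epi (grπ i n), ← Category.assoc, ← Category.assoc, grπ_ι, comp_zero,
      Category.assoc (wedgePow i (n + 1)).arrow, π_quotComul, Category.assoc, ← tensorHom_id,
      ← wedgePow_arrow_wedgeMap i (a + 1) b (n + 1) (by omega)]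
    congr 1
    rw [wedgeMap, wedgeMap, Category.assoc, tensorHom_comp_tensorHom, Category.comp_id]
    congr 2
    exact π_quotMap _ _ _
  · rw [← cancel_epi (grπ i n), ← Category.assoc, ← Category.assoc, grπ_ι, comp_zero,
      Category.assoc (wedgePow i (n + 1)).arrow, π_quotComul, Category.assoc, ← id_tensorHom,
      ← wedgePow_arrow_wedgeMap i a (b + 1) (n + 1) (by omega)]
    congr 1
    rw [wedgeMap, wedgeMap, Category.assoc, tensorHom_comp_tensorHom, Category.comp_id]
    congr 2
    exact π_quotMap _ _ _

/-- The component `gr^n ⟶ gr^a ⊗ gr^b`, for `a + b = n`, of the comultiplication of the associated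
graded coalgebra: the unique morphism compatible with `E / B^n ⟶ E / B^a ⊗ E / B^b` through the
canonical monomorphisms `gr^k ⟶ E / B^k`. -/
def grComulDeg (a b n : ℕ) (h : a + b = n) : grDeg i n ⟶ grDeg i a ⊗ grDeg i b :=
  (exists_grComulDeg i a b n h).choose

lemma grComulDeg_comp (a b n : ℕ) (h : a + b = n) :
    grComulDeg i a b n h ≫ (grι i a ⊗ₘ grι i b) = grι i n ≫ quotComul i a b n h :=
  (exists_grComulDeg i a b n h).choose_spec

variable [HasColimits M]

/-- The associated graded object `gr_B E`, the direct sum of the quotients of consecutive wedge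
powers. -/
abbrev gr {B E : M} [ComonObj E] (i : B ⟶ E) [Mono i] : M := ∐ grDeg i

/-- The comultiplication of `gr_B E`: in degree `n` it is the sum of its components
`gr^n ⟶ gr^a ⊗ gr^b` over all `a + b = n`. -/
def grComul : gr i ⟶ gr i ⊗ gr i :=
  Sigma.desc fun n => ∑ p : Finset.HasAntidiagonal.antidiagonal n,
    grComulDeg i p.1.1 p.1.2 n (Finset.HasAntidiagonal.mem_antidiagonal.mp p.2) ≫
      (Sigma.ι (grDeg i) p.1.1 ⊗ₘ Sigma.ι (grDeg i) p.1.2)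

/-- The counit of `gr_B E`: it is induced by the counit of `E` in degree `0`, and it is zero in
positive degrees. -/
def grCounit {B E : M} [ComonObj E] (i : B ⟶ E) [Mono i] : gr i ⟶ 𝟙_ M :=
  Sigma.desc fun
    | 0 => cokernel.desc _ ((wedgePow i 1).arrow ≫ ε[E]) (by
        have h : (wedgePow i 0).arrow = 0 := Subobject.bot_arrow
        rw [← Category.assoc, Subobject.ofLE_arrow, h, zero_comp])
    | _ + 1 => 0

/-- The canonical morphism from `B` to its first wedge power `0 ∧ B` (both are the same subobject
of `E`). -/
def toWedgePowOne : B ⟶ (wedgePow i 1 : M) :=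
  (Subobject.underlyingIso i).inv ≫ Subobject.ofLE (Subobject.mk i) (wedgePow i 1)
    (le_kernelSubobject _ _ (mk_arrow_wedgeMap' i _))

lemma toWedgePowOne_arrow : toWedgePowOne i ≫ (wedgePow i 1).arrow = i :=
  (Category.assoc _ _ _).trans
    ((congrArg ((Subobject.underlyingIso i).inv ≫ ·) (Subobject.ofLE_arrow _)).trans
      (Subobject.underlyingIso_arrow i))

end AssocGraded

/-! Write `B^n` for the wedge powers; `B^(n+1)` is the part of degree at most `n` of a filtration of
`E`. Everything rests on its compatibility with `Δ` and `μ`.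

The wedge conditions say that `Δ(B^(n+1))` dies in `E/B^a ⊗ E/B^b` whenever `a + b = n + 1`. As the
tensor product is exact, the intersection of these kernels is the sum of the `B^(a+1) ⊗ B^(b+1)`
with `a + b = n` (`exists_isFilteredSum_of_whiskerLeft`). The summands overlap, so a decomposition
of `Δ` is chosen only after pulling back along an epimorphism (`exists_comul_isFilteredSum`); the
epimorphism is cancelled at the end.

Multiplicativity (`wedgePow_mul_π`) is an induction on `n = a + b`. Expand `Δ(xy) = Δ(x)Δ(y)` into
terms `x'y' ⊗ x''y''`: either the degrees of `x'` and `y'` add up to less than `n` and induction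
puts `x'y'` in `B^n`, or `x''` and `y''` have degree `0` and `x''y''` lies in `B`. Hence `xy` lies
in `B^n ∧ B`.

Coalgebra identities on `gr` are tested in tensor products of the quotients `E/B^k`, algebra
identities on the wedge powers themselves. Compatibility of `Δ` and `μ` needs `toGr_grComul_of_sum`:
any decomposition of `Δ(t)` computes the graded comultiplication of the class of `t`. Uniqueness
holds because the tensor products of the maps from the wedge powers to `gr` are jointly epimorphic.
-/

/-! ### Exactness of the tensor product -/

section TensorExact

variable {M : Type u} [Category.{v} M] [Abelian M] [MonoidalCategory M]

section Left

variable [CoabelianMonoidal M]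

lemma exists_lift_whiskerLeft {T F : M} (E : M) (Y : Subobject F) (z : T ⟶ E ⊗ F)
    (h : z ≫ E ◁ cokernel.π Y.arrow = 0) : ∃ g : T ⟶ E ⊗ (Y : M), g ≫ E ◁ Y.arrow = z := by
  have ex := (ShortComplex.exact_cokernel Y.arrow).map_of_mono_of_preservesKernel
    (tensorLeft E) (inferInstanceAs (Mono Y.arrow)) inferInstance
  have : Mono ((ShortComplex.mk _ _ (cokernel.condition Y.arrow)).map (tensorLeft E)).f :=
    inferInstanceAs (Mono (E ◁ Y.arrow))
  exact ⟨ex.lift z h, ex.lift_f z h⟩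

lemma exists_lift_whiskerRight {T E : M} (F : M) (X : Subobject E) (z : T ⟶ E ⊗ F)
    (h : z ≫ cokernel.π X.arrow ▷ F = 0) : ∃ g : T ⟶ (X : M) ⊗ F, g ≫ X.arrow ▷ F = z := by
  have ex := (ShortComplex.exact_cokernel X.arrow).map_of_mono_of_preservesKernel
    (tensorRight F) (inferInstanceAs (Mono X.arrow)) inferInstance
  have : Mono ((ShortComplex.mk _ _ (cokernel.condition X.arrow)).map (tensorRight F)).f :=
    inferInstanceAs (Mono (X.arrow ▷ F))
  exact ⟨ex.lift z h, ex.lift_f z h⟩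

/-- `X ⊗ F ∩ E ⊗ Y = X ⊗ Y` inside `E ⊗ F`. -/
lemma exists_lift_tensorHom {T E F : M} (X : Subobject E) (Y : Subobject F) (z : T ⟶ E ⊗ F)
    (h1 : z ≫ cokernel.π X.arrow ▷ F = 0) (h2 : z ≫ E ◁ cokernel.π Y.arrow = 0) :
    ∃ g : T ⟶ (X : M) ⊗ (Y : M), g ≫ (X.arrow ⊗ₘ Y.arrow) = z := by
  obtain ⟨z', rfl⟩ := exists_lift_whiskerLeft E Y z h2
  -- `E/X ⊗ Y ⟶ E/X ⊗ F` is a monomorphism, so `h1` already holds for `z'`.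
  obtain ⟨g, rfl⟩ := exists_lift_whiskerRight (Y : M) X z' (by
    rw [← cancel_mono (_ ◁ Y.arrow), Category.assoc, ← whisker_exchange, ← Category.assoc, h1,
      zero_comp])
  exact ⟨g, by rw [MonoidalCategory.tensorHom_def, Category.assoc]⟩

end Left

section Right

variable [AbelianMonoidal M]

instance epi_whiskerLeft (X : M) {Y Z : M} (f : Y ⟶ Z) [Epi f] : Epi (X ◁ f) :=
  inferInstanceAs (Epi ((tensorLeft X).map f))

instance epi_whiskerRight (X : M) {Y Z : M} (f : Y ⟶ Z) [Epi f] : Epi (f ▷ X) :=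
  inferInstanceAs (Epi ((tensorRight X).map f))

instance epi_tensorHom {X Y Z W : M} (f : X ⟶ Y) (g : Z ⟶ W) [Epi f] [Epi g] :
    Epi (f ⊗ₘ g) := by
  rw [MonoidalCategory.tensorHom_def]; infer_instance

/-- A morphism on `X ⊗ Y` that kills `K ⊗ Y` and `X ⊗ L` descends to `X / K ⊗ Y / L`. -/
lemma exists_desc_tensorHom {K X L Y Z : M} (k : K ⟶ X) (l : L ⟶ Y) (f : X ⊗ Y ⟶ Z)
    (h1 : k ▷ Y ≫ f = 0) (h2 : X ◁ l ≫ f = 0) :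
    ∃ g : cokernel k ⊗ cokernel l ⟶ Z, (cokernel.π k ⊗ₘ cokernel.π l) ≫ g = f := by
  have exk := (ShortComplex.exact_cokernel k).map_of_epi_of_preservesCokernel
    (tensorRight Y) (inferInstanceAs (Epi (cokernel.π k))) inferInstance
  have exl := (ShortComplex.exact_cokernel l).map_of_epi_of_preservesCokernel
    (tensorLeft (cokernel k)) (inferInstanceAs (Epi (cokernel.π l))) inferInstance
  have : Epi ((ShortComplex.mk _ _ (cokernel.condition k)).map (tensorRight Y)).g :=
    inferInstanceAs (Epi (cokernel.π k ▷ Y))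
  have : Epi ((ShortComplex.mk _ _ (cokernel.condition l)).map (tensorLeft (cokernel k))).g :=
    inferInstanceAs (Epi (cokernel k ◁ cokernel.π l))
  obtain ⟨f', hf'⟩ : ∃ f' : cokernel k ⊗ Y ⟶ Z, cokernel.π k ▷ Y ≫ f' = f :=
    ⟨exk.desc f h1, exk.g_desc f h1⟩
  have h3 : cokernel k ◁ l ≫ f' = 0 := by
    rw [← cancel_epi (cokernel.π k ▷ L), ← Category.assoc, ← whisker_exchange, Category.assoc, hf',
      h2, comp_zero]
  obtain ⟨g, hg⟩ : ∃ g : cokernel k ⊗ cokernel l ⟶ Z, cokernel k ◁ cokernel.π l ≫ g = f' :=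
    ⟨exl.desc f' h3, exl.g_desc f' h3⟩
  exact ⟨g, by rw [MonoidalCategory.tensorHom_def, Category.assoc, hg, hf']⟩

end Right

end TensorExact

/-! ### The tensor product and direct sums -/

section TensorSum

variable {M : Type u} [Category.{v} M] [HasColimits M]

section

variable {N : Type u} [Category.{v} N] (F : M ⥤ N) [PreservesColimitsOfShape (Discrete ℕ) F]
  (X : ℕ → M)

/-- The image of a direct sum under a functor that preserves direct sums, as a colimit. -/
noncomputable def isColimitMapSigma :
    IsColimit (Cofan.mk (F.obj (∐ X)) fun n => F.map (Sigma.ι X n)) :=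
  isColimitCofanMkObjOfIsColimit F X _ (coproductIsCoproduct X)

lemma map_sigma_hom_ext {Z : N} {f g : F.obj (∐ X) ⟶ Z}
    (h : ∀ n, F.map (Sigma.ι X n) ≫ f = F.map (Sigma.ι X n) ≫ g) : f = g :=
  Cofan.IsColimit.hom_ext (isColimitMapSigma F X) _ _ h

lemma exists_map_sigma_desc {Z : N} (φ : ∀ n, F.obj (X n) ⟶ Z) :
    ∃ f : F.obj (∐ X) ⟶ Z, ∀ n, F.map (Sigma.ι X n) ≫ f = φ n :=
  ⟨Cofan.IsColimit.desc (isColimitMapSigma F X) φ,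
    fun n => Cofan.IsColimit.fac (isColimitMapSigma F X) φ n⟩

end

variable [MonoidalCategory M] [TensorCommutesWithDirectSums M]

/-- The assumption on direct sums concerns index types in `Type v`, so `ℕ` is reached through
`ULift`. -/
instance (X : M) : PreservesColimitsOfShape (Discrete ℕ) (tensorLeft X) :=
  preservesColimitsOfShape_of_equiv (Discrete.equivalence Equiv.ulift.{v}) _

instance (X : M) : PreservesColimitsOfShape (Discrete ℕ) (tensorRight X) :=
  preservesColimitsOfShape_of_equiv (Discrete.equivalence Equiv.ulift.{v}) _

lemma tensor_sigma_hom_ext {X Y : ℕ → M} {Z : M} {f g : (∐ X) ⊗ (∐ Y) ⟶ Z}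
    (h : ∀ a b, (Sigma.ι X a ⊗ₘ Sigma.ι Y b) ≫ f = (Sigma.ι X a ⊗ₘ Sigma.ι Y b) ≫ g) :
    f = g := by
  refine map_sigma_hom_ext (tensorRight (∐ Y)) X fun a =>
    map_sigma_hom_ext (tensorLeft (X a)) Y fun b => ?_
  simpa [MonoidalCategory.tensorHom_def'] using h a b

lemma tensor_tensor_sigma_hom_ext {X Y W : ℕ → M} {Z : M} {f g : ((∐ X) ⊗ (∐ Y)) ⊗ (∐ W) ⟶ Z}
    (h : ∀ a b c, ((Sigma.ι X a ⊗ₘ Sigma.ι Y b) ⊗ₘ Sigma.ι W c) ≫ f =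
      ((Sigma.ι X a ⊗ₘ Sigma.ι Y b) ⊗ₘ Sigma.ι W c) ≫ g) :
    f = g := by
  -- One variable is decomposed at a time; each composite of tensor functors still preserves direct
  -- sums.
  refine map_sigma_hom_ext (tensorRight (∐ Y) ⋙ tensorRight (∐ W)) X fun a =>
    map_sigma_hom_ext (tensorLeft (X a) ⋙ tensorRight (∐ W)) Y fun b =>
    map_sigma_hom_ext (tensorLeft (X a ⊗ Y b)) W fun c => ?_
  simpa [MonoidalCategory.tensorHom_def'] using h a b c

lemma exists_tensor_sigma_desc {X Y : ℕ → M} {Z : M} (φ : ∀ a b, X a ⊗ Y b ⟶ Z) :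
    ∃ f : (∐ X) ⊗ (∐ Y) ⟶ Z, ∀ a b, (Sigma.ι X a ⊗ₘ Sigma.ι Y b) ≫ f = φ a b := by
  choose f hf using fun a => exists_map_sigma_desc (tensorLeft (X a)) Y (φ a)
  obtain ⟨g, hg⟩ := exists_map_sigma_desc (tensorRight (∐ Y)) X f
  refine ⟨g, fun a b => ?_⟩
  rw [← hf, ← hg, MonoidalCategory.tensorHom_def', Category.assoc]
  rfl

end TensorSum

/-! ### Decomposition of the comultiplication along the wedge filtration -/

section Filtration

variable {M : Type u} [Category.{v} M] [Abelian M] [MonoidalCategory M]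

section

variable {B E : M} [ComonObj E] (i : B ⟶ E) [Mono i]

/-- A morphism to `E ⊗ E` that is a sum of morphisms to `B^(a+1) ⊗ B^(b+1)` with `a + b = n`. -/
def IsFilteredSum (n : ℕ) {T : M} (w : T ⟶ E ⊗ E) : Prop :=
  ∃ x : ∀ p : ℕ × ℕ, T ⟶ (wedgePow i (p.1 + 1) : M) ⊗ (wedgePow i (p.2 + 1) : M),
    w = ∑ p ∈ Finset.HasAntidiagonal.antidiagonal n,
      x p ≫ ((wedgePow i (p.1 + 1)).arrow ⊗ₘ (wedgePow i (p.2 + 1)).arrow)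

variable {i}

lemma IsFilteredSum.add {n : ℕ} {T : M} {w w' : T ⟶ E ⊗ E} (h : IsFilteredSum i n w)
    (h' : IsFilteredSum i n w') : IsFilteredSum i n (w + w') := by
  obtain ⟨x, rfl⟩ := h
  obtain ⟨x', rfl⟩ := h'
  exact ⟨fun p => x p + x' p, by simp [Finset.sum_add_distrib]⟩

lemma IsFilteredSum.comp {n : ℕ} {T T' : M} {w : T ⟶ E ⊗ E} (h : IsFilteredSum i n w)
    (q : T' ⟶ T) : IsFilteredSum i n (q ≫ w) := by
  obtain ⟨x, rfl⟩ := h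
  exact ⟨fun p => q ≫ x p, by simp [Preadditive.comp_sum]⟩

variable (i)

lemma isFilteredSum_zero (n : ℕ) (T : M) : IsFilteredSum i n (0 : T ⟶ E ⊗ E) :=
  ⟨fun _ => 0, by simp⟩

lemma isFilteredSum_single {n a b : ℕ} (h : a + b = n) {T : M}
    (x : T ⟶ (wedgePow i (a + 1) : M) ⊗ (wedgePow i (b + 1) : M)) :
    IsFilteredSum i n (x ≫ ((wedgePow i (a + 1)).arrow ⊗ₘ (wedgePow i (b + 1)).arrow)) := by
  refine ⟨Pi.single (a, b) x, ?_⟩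
  rw [Finset.sum_eq_single (a, b)]
  · simp
  · intro p _ hp
    simp [Pi.single_eq_of_ne hp]
  · simp [Finset.HasAntidiagonal.mem_antidiagonal, h]

end

variable [CoabelianMonoidal M]

section

variable {B E : M} [ComonObj E] (i : B ⟶ E) [Mono i]

lemma wedgePow_arrow_π {a n : ℕ} (h : a ≤ n) :
    (wedgePow i a).arrow ≫ cokernel.π (wedgePow i n).arrow = 0 := by
  rw [← Subobject.ofLE_arrow (wedgePow_mono i h), Category.assoc, cokernel.condition, comp_zero]

/-- `B^0` is zero. Hence a vanishing condition in `E/B^0 ⊗ E/B^b` can be read in `E ⊗ E/B^b`. -/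
instance mono_π_wedgePow_zero : Mono (cokernel.π (wedgePow i 0).arrow) := by
  rw [Preadditive.mono_iff_cancel_zero]
  intro T t ht
  obtain ⟨x, rfl⟩ := exists_lift_of_comp_π _ t ht
  have h : (wedgePow i 0).arrow = 0 := Subobject.bot_arrow
  rw [h, comp_zero]

instance isIso_π_wedgePow_zero : IsIso (cokernel.π (wedgePow i 0).arrow) :=
  isIso_of_mono_of_epi _

/-- Elements of `B^(a+1) ⊗ B^(b+1)` vanish in `E / B^c ⊗ E / B^d` if `a < c` or `b < d`. -/
lemma wedgePow_arrow_tensor_π {a b c d : ℕ} (h : a + 1 ≤ c ∨ b + 1 ≤ d) :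
    ((wedgePow i (a + 1)).arrow ⊗ₘ (wedgePow i (b + 1)).arrow) ≫
      (cokernel.π (wedgePow i c).arrow ⊗ₘ cokernel.π (wedgePow i d).arrow) = 0 := by
  rw [tensorHom_comp_tensorHom]
  rcases h with h | h <;> simp [wedgePow_arrow_π i h]

variable [AbelianMonoidal M]

/-- A morphism to `E ⊗ E` that vanishes in `E / B^a ⊗ E / B^b` whenever `a + b = n + 1` is, up to
refinement, a sum of morphisms to `B^(a+1) ⊗ B^(b+1)` with `a + b = n`. -/
lemma exists_isFilteredSum_of_whiskerLeft (n : ℕ) {r : ℕ} (hr : r ≤ n + 1) {T : M}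
    (w : T ⟶ E ⊗ E) (h1 : w ≫ E ◁ cokernel.π (wedgePow i r).arrow = 0)
    (h2 : ∀ a b, a + b = n + 1 →
      w ≫ (cokernel.π (wedgePow i a).arrow ⊗ₘ cokernel.π (wedgePow i b).arrow) = 0) :
    ∃ (T' : M) (q : T' ⟶ T) (_ : Epi q), IsFilteredSum i n (q ≫ w) := by
  -- `w` lies in `E ⊗ B^r`; each step peels off one summand and lowers `r` by one.
  induction r generalizing T with
  | zero =>
    refine ⟨T, 𝟙 T, inferInstance, ?_⟩
    obtain rfl : w = 0 := by rw [← cancel_mono (E ◁ cokernel.π (wedgePow i 0).arrow), h1, zero_comp]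
    simpa using isFilteredSum_zero i n T
  | succ r ih =>
    obtain ⟨k, rfl⟩ : ∃ k, n = k + r := ⟨n - r, by omega⟩
    -- By `h2` at `(k + 1, r)`, the image of `w` in `E/B^(k+1) ⊗ E` comes from `E/B^(k+1) ⊗ B^r`.
    -- Its lift `z₁` to `E ⊗ B^r`, which exists up to refinement, is the remainder.
    obtain ⟨z, hz⟩ := exists_lift_whiskerLeft (cokernel (wedgePow i (k + 1)).arrow) (wedgePow i r)
      (w ≫ cokernel.π (wedgePow i (k + 1)).arrow ▷ E) (by
        rw [Category.assoc, ← MonoidalCategory.tensorHom_def]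
        exact h2 _ _ (by omega))
    obtain ⟨T₁, q₁, hq₁, z₁, hz₁⟩ := surjective_up_to_refinements_of_epi
      (cokernel.π (wedgePow i (k + 1)).arrow ▷ (wedgePow i r : M)) z
    have h3 : (z₁ ≫ E ◁ (wedgePow i r).arrow) ≫ cokernel.π (wedgePow i (k + 1)).arrow ▷ E =
        q₁ ≫ w ≫ cokernel.π (wedgePow i (k + 1)).arrow ▷ E := by
      rw [Category.assoc, whisker_exchange, ← Category.assoc, ← hz₁, Category.assoc, hz]
    -- The difference lies in `B^(k+1) ⊗ E` and in `E ⊗ B^(r+1)`, hence in the summand of degree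
    -- `(k, r)`.
    obtain ⟨x, hx⟩ := exists_lift_tensorHom (wedgePow i (k + 1)) (wedgePow i (r + 1))
      (q₁ ≫ w - z₁ ≫ E ◁ (wedgePow i r).arrow)
      (by rw [Preadditive.sub_comp, h3, Category.assoc, sub_self])
      (by
        rw [Preadditive.sub_comp, Category.assoc, h1, Category.assoc, ← whiskerLeft_comp,
          wedgePow_arrow_π i r.le_succ]
        simp)
    obtain ⟨T₂, q₂, hq₂, hw⟩ := ih (by omega) (z₁ ≫ E ◁ (wedgePow i r).arrow)
      (by rw [Category.assoc, ← whiskerLeft_comp, cokernel.condition]; simp)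
      -- The remainder inherits `h2`: as `a + b = k + r + 1`, either `a > k` or `b > r`, so the
      -- split-off summand dies in `E/B^a ⊗ E/B^b`.
      (fun a b hab => by
        rw [← sub_sub_cancel (q₁ ≫ w) (z₁ ≫ _), ← hx, Preadditive.sub_comp, Category.assoc,
          h2 a b hab, Category.assoc, wedgePow_arrow_tensor_π i (by omega)]
        simp)
    refine ⟨T₂, q₂ ≫ q₁, inferInstance, ?_⟩
    have e : (q₂ ≫ q₁) ≫ w = q₂ ≫ (x ≫ ((wedgePow i (k + 1)).arrow ⊗ₘ
        (wedgePow i (r + 1)).arrow)) + q₂ ≫ z₁ ≫ E ◁ (wedgePow i r).arrow := by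
      rw [hx, Preadditive.comp_sub, sub_add_cancel, Category.assoc]
    rw [e]
    exact ((isFilteredSum_single i rfl x).comp q₂).add hw

variable [ComonObj B] [IsComonHom i]

/-- The peeling argument starts at `r = n + 1`: the wedge condition at `(0, n + 1)` says that `Δ`
sends `B^(n+1)` into `E ⊗ B^(n+1)`. -/
lemma exists_comul_isFilteredSum (n : ℕ) :
    ∃ (T : M) (q : T ⟶ (wedgePow i (n + 1) : M)) (_ : Epi q),
      IsFilteredSum i n (q ≫ (wedgePow i (n + 1)).arrow ≫ Δ[E]) := by
  have h (a b : ℕ) (hab : a + b = n + 1) : ((wedgePow i (n + 1)).arrow ≫ Δ[E]) ≫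
      (cokernel.π (wedgePow i a).arrow ⊗ₘ cokernel.π (wedgePow i b).arrow) = 0 := by
    rw [Category.assoc]
    exact wedgePow_arrow_wedgeMap i a b _ hab
  refine exists_isFilteredSum_of_whiskerLeft i n le_rfl _ ?_ h
  rw [← cancel_mono (cokernel.π (wedgePow i 0).arrow ▷ _), zero_comp, Category.assoc,
    ← MonoidalCategory.tensorHom_def']
  exact h 0 (n + 1) (by omega)

end

section

variable {B E : M} [ComonObj E] (i : B ⟶ E) [Mono i]

/-- `Δ` maps `0 ∧ B` into `E ⊗ B`; applying `ε` to the first factor recovers the element and puts it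
in `B`. -/
lemma wedgePow_arrow_π_mk : (wedgePow i 1).arrow ≫ cokernel.π (Subobject.mk i).arrow = 0 := by
  have h : ((wedgePow i 1).arrow ≫ Δ[E]) ≫ E ◁ cokernel.π (Subobject.mk i).arrow = 0 := by
    rw [← cancel_mono (cokernel.π (wedgePow i 0).arrow ▷ _), zero_comp, Category.assoc,
      ← MonoidalCategory.tensorHom_def', Category.assoc]
    exact wedge_arrow_wedgeMap (wedgePow i 0) (Subobject.mk i)
  have h' := h =≫ (ε[E] ▷ _)
  rw [Category.assoc, Category.assoc, whisker_exchange, ComonObj.counit_comul_assoc,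
    ← leftUnitor_inv_naturality, zero_comp, ← Category.assoc] at h'
  rwa [← cancel_mono (λ_ _).inv, zero_comp]

end

end Filtration

/-! ### The wedge filtration is multiplicative -/

section Multiplicative

variable {M : Type u} [Category.{v} M] [Abelian M] [MonoidalCategory M] [BraidedCategory M]
  [CoabelianMonoidal M] {B E : M} [BimonObj B] [BimonObj E] (i : B ⟶ E) [Mono i] [IsBimonHom i]

/-- `B^1` factors through `B`, and `i` is multiplicative. This handles the degree `0` factors in the
induction below. -/
lemma wedgePow_one_mul_wedgePow_one :
    ((wedgePow i 1).arrow ⊗ₘ (wedgePow i 1).arrow) ≫ μ[E] ≫ cokernel.π (Subobject.mk i).arrow =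
      0 := by
  obtain ⟨x, hx⟩ : ∃ x : (wedgePow i 1 : M) ⟶ B, x ≫ i = (wedgePow i 1).arrow := by
    obtain ⟨x, hx⟩ := exists_lift_of_comp_π _ _ (wedgePow_arrow_π_mk i)
    exact ⟨x ≫ (Subobject.underlyingIso i).hom, by
      rw [Category.assoc, Subobject.underlyingIso_hom_comp_eq_mk, hx]⟩
  rw [← hx, ← tensorHom_comp_tensorHom, Category.assoc, ← IsMonHom.mul_hom_assoc, comp_π_mk,
    comp_zero, comp_zero]

variable [AbelianMonoidal M]

/-- The multiplication of `E` maps `B^(a+1) ⊗ B^(b+1)` to `B^(a+b+1)`. -/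
lemma wedgePow_mul_π (a b n : ℕ) (h : a + b = n) :
    ((wedgePow i (a + 1)).arrow ⊗ₘ (wedgePow i (b + 1)).arrow) ≫ μ[E] ≫
      cokernel.π (wedgePow i (n + 1)).arrow = 0 := by
  induction n using Nat.strong_induction_on generalizing a b with
  | _ n ih =>
  -- `E/(B^n ∧ B)` embeds into `E/B^n ⊗ E/B`, so the product may be tested after applying `Δ`.
  suffices h0 : ((wedgePow i (a + 1)).arrow ⊗ₘ (wedgePow i (b + 1)).arrow) ≫ μ[E] ≫
      wedgeMap (wedgePow i n) (Subobject.mk i) = 0 by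
    have h1 : (((wedgePow i (a + 1)).arrow ⊗ₘ (wedgePow i (b + 1)).arrow) ≫ μ[E]) ≫
        cokernel.π (wedge (wedgePow i n) (Subobject.mk i)).arrow = 0 := by
      rw [← cancel_mono (wedgeBar (wedgePow i n) (Subobject.mk i)), zero_comp, Category.assoc,
        π_wedgeBar, Category.assoc, h0]
    exact (Category.assoc _ _ _).symm.trans h1
  obtain ⟨T, q, hq, x, hx⟩ := exists_comul_isFilteredSum i a
  obtain ⟨T', q', hq', y, hy⟩ := exists_comul_isFilteredSum i b
  rw [← cancel_epi (q ⊗ₘ q'), comp_zero, wedgeMap, BimonObj.mul_comul_assoc,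
    tensorHom_comp_tensorHom_assoc, tensorHom_comp_tensorHom_assoc, Category.assoc, Category.assoc,
    hx, hy, sum_tensor, Preadditive.sum_comp]
  refine Finset.sum_eq_zero fun p hp => ?_
  rw [tensor_sum, Preadditive.sum_comp]
  refine Finset.sum_eq_zero fun r hr => ?_
  rw [Finset.HasAntidiagonal.mem_antidiagonal] at hp hr
  rw [← tensorHom_comp_tensorHom, Category.assoc, tensorμ_natural_assoc, tensorHom_comp_tensorHom,
    tensorHom_comp_tensorHom]
  -- It is enough that in each term the left product lies in `B^n` or the right product lies in `B`.
  suffices h0 : ((wedgePow i (p.1 + 1)).arrow ⊗ₘ (wedgePow i (r.1 + 1)).arrow) ≫ μ[E] ≫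
      cokernel.π (wedgePow i n).arrow = 0 ∨
      ((wedgePow i (p.2 + 1)).arrow ⊗ₘ (wedgePow i (r.2 + 1)).arrow) ≫ μ[E] ≫
      cokernel.π (Subobject.mk i).arrow = 0 by
    rcases h0 with h0 | h0 <;> simp [h0]
  by_cases hlt : p.1 + r.1 < n
  · left
    have h1 := ih (p.1 + r.1) hlt p.1 r.1 rfl
    rw [← Category.assoc] at h1 ⊢
    obtain ⟨z, hz⟩ := exists_lift_of_comp_π _ _ h1
    rw [← hz, Category.assoc, wedgePow_arrow_π i hlt, comp_zero]
  · right
    -- The four degrees add up to `n`, so nothing is left for the right factors.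
    obtain ⟨h1, h2⟩ : p.2 = 0 ∧ r.2 = 0 := by omega
    rw [h1, h2]
    exact wedgePow_one_mul_wedgePow_one i

lemma exists_wedgePow_mul (a b n : ℕ) (h : a + b = n) :
    ∃ m : (wedgePow i (a + 1) : M) ⊗ (wedgePow i (b + 1) : M) ⟶ (wedgePow i (n + 1) : M),
      m ≫ (wedgePow i (n + 1)).arrow =
        ((wedgePow i (a + 1)).arrow ⊗ₘ (wedgePow i (b + 1)).arrow) ≫ μ[E] :=
  exists_lift_of_comp_π _ _ ((Category.assoc _ _ _).trans (wedgePow_mul_π i a b n h))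

end Multiplicative

/-! ### The associated graded object is a coalgebra -/

lemma ι_tensorDegι {M : Type u} [Category.{v} M] [HasColimits M] [Abelian M] [MonoidalCategory M]
    (X Y : ℕ → M) (n : ℕ) (p : Finset.HasAntidiagonal.antidiagonal n) :
    (Sigma.ι (fun p : Finset.HasAntidiagonal.antidiagonal n => X p.1.1 ⊗ Y p.1.2) p ≫
      tensorDegι X Y n : X p.1.1 ⊗ Y p.1.2 ⟶ (∐ X) ⊗ (∐ Y)) =
      Sigma.ι X p.1.1 ⊗ₘ Sigma.ι Y p.1.2 :=
  Sigma.ι_desc _ _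

section GradedCoalgebra

variable {M : Type u} [Category.{v} M] [Abelian M] [MonoidalCategory M] [CoabelianMonoidal M]
  {B E : M} [ComonObj E] (i : B ⟶ E) [Mono i] [ComonObj B] [IsComonHom i]

lemma grπ_grComulDeg (a b n : ℕ) (h : a + b = n) :
    grπ i n ≫ grComulDeg i a b n h ≫ (grι i a ⊗ₘ grι i b) =
      (wedgePow i (n + 1)).arrow ≫ Δ[E] ≫
        (cokernel.π (wedgePow i a).arrow ⊗ₘ cokernel.π (wedgePow i b).arrow) := by
  rw [grComulDeg_comp, ← Category.assoc, grπ_ι, Category.assoc, π_quotComul, wedgeMap]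

/-- The components of the comultiplication of the associated graded coalgebra, extended by zero
to all pairs of degrees. -/
noncomputable def grComulPart (n : ℕ) (p : ℕ × ℕ) : grDeg i n ⟶ grDeg i p.1 ⊗ grDeg i p.2 :=
  if h : p.1 + p.2 = n then grComulDeg i p.1 p.2 n h else 0

lemma grComulPart_eq {n a b : ℕ} (h : a + b = n) :
    grComulPart i n (a, b) = grComulDeg i a b n h :=
  dif_pos h

/-- Embedded in `E/B^a ⊗ E/B^b ⊗ E/B^c` and precomposed with `grπ`, both sides are projections of
the iterated `Δ` of `E`. Keeping `s`, `t`, `n` as variables avoids transport along equalities of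
degrees. -/
lemma grComulDeg_coassoc (a b c s t n : ℕ) (hs : a + b = s) (ht : b + c = t) (h : s + c = n)
    (h' : a + t = n) :
    grComulDeg i a t n h' ≫ grDeg i a ◁ grComulDeg i b c t ht =
      grComulDeg i s c n h ≫ grComulDeg i a b s hs ▷ grDeg i c ≫ (α_ _ _ _).hom := by
  rw [← cancel_mono (grι i a ⊗ₘ grι i b ⊗ₘ grι i c), ← cancel_epi (grπ i n)]
  have e1 : (grDeg i a ◁ grComulDeg i b c t ht) ≫ (grι i a ⊗ₘ grι i b ⊗ₘ grι i c) =
      (grι i a ⊗ₘ grι i t) ≫ (quotPow i a ◁ quotComul i b c t ht) := by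
    rw [← id_tensorHom, tensorHom_comp_tensorHom, grComulDeg_comp, ← id_tensorHom,
      tensorHom_comp_tensorHom, Category.id_comp, Category.comp_id]
  have e2 : (grComulDeg i a b s hs ▷ grDeg i c) ≫ ((grι i a ⊗ₘ grι i b) ⊗ₘ grι i c) =
      (grι i s ⊗ₘ grι i c) ≫ (quotComul i a b s hs ▷ quotPow i c) := by
    rw [← tensorHom_id, tensorHom_comp_tensorHom, grComulDeg_comp, ← tensorHom_id,
      tensorHom_comp_tensorHom, Category.id_comp, Category.comp_id]
  have e3 : (cokernel.π (wedgePow i a).arrow ⊗ₘ cokernel.π (wedgePow i t).arrow) ≫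
      (quotPow i a ◁ quotComul i b c t ht) = cokernel.π (wedgePow i a).arrow ⊗ₘ
        wedgeMap (wedgePow i b) (wedgePow i c) := by
    rw [← id_tensorHom, tensorHom_comp_tensorHom, π_quotComul, Category.comp_id]
  have e4 : (cokernel.π (wedgePow i s).arrow ⊗ₘ cokernel.π (wedgePow i c).arrow) ≫
      (quotComul i a b s hs ▷ quotPow i c) = wedgeMap (wedgePow i a) (wedgePow i b) ⊗ₘ
        cokernel.π (wedgePow i c).arrow := by
    rw [← tensorHom_id, tensorHom_comp_tensorHom, π_quotComul, Category.comp_id]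
  have l := grπ_grComulDeg i a t n h' =≫ (quotPow i a ◁ quotComul i b c t ht)
  have r := grπ_grComulDeg i s c n h =≫ ((quotComul i a b s hs ▷ quotPow i c) ≫ (α_ _ _ _).hom)
  simp only [Category.assoc, e3] at l
  simp only [Category.assoc, reassoc_of% e4] at r
  simp only [Category.assoc, ← associator_naturality]
  rw [e1, l, reassoc_of% e2, r, comul_wedgeMap_assoc]

variable [HasColimits M]

lemma ι_grComul (n : ℕ) :
    Sigma.ι (grDeg i) n ≫ grComul i = ∑ p ∈ Finset.HasAntidiagonal.antidiagonal n,
      grComulPart i n p ≫ (Sigma.ι (grDeg i) p.1 ⊗ₘ Sigma.ι (grDeg i) p.2) := by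
  rw [grComul, Sigma.ι_desc, ← Finset.sum_coe_sort (Finset.HasAntidiagonal.antidiagonal n)
    fun p => grComulPart i n p ≫ (Sigma.ι (grDeg i) p.1 ⊗ₘ Sigma.ι (grDeg i) p.2)]
  refine Finset.sum_congr rfl fun p _ => ?_
  rw [← grComulPart_eq]

lemma grComul_coassoc :
    grComul i ≫ gr i ◁ grComul i = grComul i ≫ grComul i ▷ gr i ≫ (α_ _ _ _).hom := by
  refine Sigma.hom_ext _ _ fun n => ?_
  have e1 (p : ℕ × ℕ) : (Sigma.ι (grDeg i) p.1 ⊗ₘ Sigma.ι (grDeg i) p.2) ≫ gr i ◁ grComul i =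
      ∑ r ∈ Finset.HasAntidiagonal.antidiagonal p.2, grDeg i p.1 ◁ grComulPart i p.2 r ≫
        (Sigma.ι (grDeg i) p.1 ⊗ₘ Sigma.ι (grDeg i) r.1 ⊗ₘ Sigma.ι (grDeg i) r.2) := by
    rw [← id_tensorHom, tensorHom_comp_tensorHom, ι_grComul, tensor_sum]
    refine Finset.sum_congr rfl fun r _ => ?_
    rw [← id_tensorHom, tensorHom_comp_tensorHom, Category.id_comp, Category.comp_id]
  have e2 (p : ℕ × ℕ) : (Sigma.ι (grDeg i) p.1 ⊗ₘ Sigma.ι (grDeg i) p.2) ≫ grComul i ▷ gr i ≫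
      (α_ _ _ _).hom =
      ∑ r ∈ Finset.HasAntidiagonal.antidiagonal p.1, grComulPart i p.1 r ▷ grDeg i p.2 ≫
        (α_ _ _ _).hom ≫
        (Sigma.ι (grDeg i) r.1 ⊗ₘ Sigma.ι (grDeg i) r.2 ⊗ₘ Sigma.ι (grDeg i) p.2) := by
    rw [← tensorHom_id, tensorHom_comp_tensorHom_assoc, ι_grComul, sum_tensor, Preadditive.sum_comp]
    refine Finset.sum_congr rfl fun r _ => ?_
    rw [← tensorHom_id, ← associator_naturality, tensorHom_comp_tensorHom_assoc, Category.id_comp,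
      Category.comp_id]
  rw [reassoc_of% (ι_grComul i n), reassoc_of% (ι_grComul i n)]
  simp only [Preadditive.sum_comp, Category.assoc, e1, e2, Preadditive.comp_sum]
  rw [Finset.sum_sigma', Finset.sum_sigma']
  -- Both double sums run over triples `a + b + c = n`, bracketed as `a + (b + c)` and as `(a + b) +
  -- c`.
  refine Finset.sum_bij' (fun x _ => ⟨(x.1.1 + x.2.1, x.2.2), (x.1.1, x.2.1)⟩)
    (fun x _ => ⟨(x.2.1, x.2.2 + x.1.2), (x.2.2, x.1.2)⟩) ?_ ?_ ?_ ?_ ?_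
  · rintro ⟨⟨a, t⟩, b, c⟩ h
    simp only [Finset.mem_sigma, Finset.HasAntidiagonal.mem_antidiagonal] at h ⊢
    exact ⟨by omega, trivial⟩
  · rintro ⟨⟨s, c⟩, a, b⟩ h
    simp only [Finset.mem_sigma, Finset.HasAntidiagonal.mem_antidiagonal] at h ⊢
    exact ⟨by omega, trivial⟩
  · rintro ⟨⟨a, t⟩, b, c⟩ h
    simp only [Finset.mem_sigma, Finset.HasAntidiagonal.mem_antidiagonal] at h
    obtain ⟨-, rfl⟩ := h
    rfl
  · rintro ⟨⟨s, c⟩, a, b⟩ h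
    simp only [Finset.mem_sigma, Finset.HasAntidiagonal.mem_antidiagonal] at h
    obtain ⟨-, rfl⟩ := h
    rfl
  · rintro ⟨⟨a, t⟩, b, c⟩ h
    simp only [Finset.mem_sigma, Finset.HasAntidiagonal.mem_antidiagonal] at h
    obtain ⟨h, ht⟩ := h
    dsimp only
    rw [grComulPart_eq i h, grComulPart_eq i ht, grComulPart_eq i rfl,
      grComulPart_eq i (show a + b + c = n by omega),
      ← Category.assoc, grComulDeg_coassoc i a b c (a + b) t n rfl ht (by omega) h]
    simp only [Category.assoc]

section Counit

variable {B E : M} [ComonObj E] (i : B ⟶ E) [Mono i]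

/-- The degree zero component of the counit. -/
lemma grπ_zero_grCounit :
    grπ i 0 ≫ Sigma.ι (grDeg i) 0 ≫ grCounit i = (wedgePow i 1).arrow ≫ ε[E] := by
  rw [grCounit, colimit.ι_desc]
  exact cokernel.π_desc _ _ _

lemma ι_succ_grCounit (n : ℕ) : Sigma.ι (grDeg i) (n + 1) ≫ grCounit i = 0 := by
  rw [grCounit, colimit.ι_desc]
  rfl

/-- Since `E ⟶ E/B^0` is an isomorphism, the counit of `gr^0` extends along `grι` to the whole
quotient, where it can be compared with `ε` of `E`. -/
lemma exists_ι_zero_grCounit : ∃ e : quotPow i 0 ⟶ 𝟙_ M,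
    cokernel.π (wedgePow i 0).arrow ≫ e = ε[E] ∧
      grι i 0 ≫ e = Sigma.ι (grDeg i) 0 ≫ grCounit i := by
  refine ⟨inv (cokernel.π (wedgePow i 0).arrow) ≫ ε[E], by simp, ?_⟩
  rw [← cancel_epi (grπ i 0), grπ_zero_grCounit, ← Category.assoc, grπ_ι]
  simp

end Counit

lemma grCounit_comul : grComul i ≫ grCounit i ▷ gr i = (λ_ (gr i)).inv := by
  refine Sigma.hom_ext _ _ fun n => ?_
  -- The counit vanishes in positive degrees, so only the component `(0, n)` contributes.
  rw [reassoc_of% (ι_grComul i n), Preadditive.sum_comp, Finset.sum_eq_single (0, n)]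
  · obtain ⟨e, he, he'⟩ := exists_ι_zero_grCounit i
    have h1 : (Sigma.ι (grDeg i) 0 ⊗ₘ Sigma.ι (grDeg i) n) ≫ grCounit i ▷ gr i =
        (grι i 0 ≫ e) ▷ grDeg i n ≫ 𝟙_ M ◁ Sigma.ι (grDeg i) n := by
      rw [← tensorHom_id, tensorHom_comp_tensorHom, ← he', Category.comp_id,
        ← MonoidalCategory.tensorHom_def]
    have h2 : grComulDeg i 0 n n (zero_add n) ≫ (grι i 0 ≫ e) ▷ grDeg i n = (λ_ _).inv := by
      rw [← cancel_mono (𝟙_ M ◁ grι i n), ← cancel_epi (grπ i n), Category.assoc,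
        ← MonoidalCategory.tensorHom_def]
      have h3 : (grι i 0 ≫ e) ⊗ₘ grι i n = (grι i 0 ⊗ₘ grι i n) ≫ e ▷ _ := by
        rw [← tensorHom_id, tensorHom_comp_tensorHom, Category.comp_id]
      have h4 := grπ_grComulDeg i 0 n n (zero_add n) =≫ (e ▷ _)
      simp only [Category.assoc] at h4
      rw [h3, h4, ← tensorHom_id, tensorHom_comp_tensorHom, Category.comp_id, he,
        MonoidalCategory.tensorHom_def, ComonObj.counit_comul_assoc, ← leftUnitor_inv_naturality,
        ← leftUnitor_inv_naturality, ← Category.assoc, ← Category.assoc, grπ_ι]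
    rw [Category.assoc, h1, grComulPart_eq i (zero_add n), reassoc_of% h2,
      leftUnitor_inv_naturality]
  · rintro ⟨a, b⟩ hp hne
    rw [Finset.HasAntidiagonal.mem_antidiagonal] at hp
    obtain ⟨a, rfl⟩ : ∃ a', a = a' + 1 := Nat.exists_eq_succ_of_ne_zero (by
      rintro rfl
      exact hne (by simp_all))
    rw [Category.assoc, ← tensorHom_id, tensorHom_comp_tensorHom, ι_succ_grCounit]
    simp
  · intro h
    simp [Finset.HasAntidiagonal.mem_antidiagonal] at h

lemma grComul_counit : grComul i ≫ gr i ◁ grCounit i = (ρ_ (gr i)).inv := by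
  refine Sigma.hom_ext _ _ fun n => ?_
  rw [reassoc_of% (ι_grComul i n), Preadditive.sum_comp, Finset.sum_eq_single (n, 0)]
  · obtain ⟨e, he, he'⟩ := exists_ι_zero_grCounit i
    have h1 : (Sigma.ι (grDeg i) n ⊗ₘ Sigma.ι (grDeg i) 0) ≫ gr i ◁ grCounit i =
        grDeg i n ◁ (grι i 0 ≫ e) ≫ Sigma.ι (grDeg i) n ▷ 𝟙_ M := by
      rw [← id_tensorHom, tensorHom_comp_tensorHom, ← he', Category.comp_id,
        ← MonoidalCategory.tensorHom_def']
    have h2 : grComulDeg i n 0 n (add_zero n) ≫ grDeg i n ◁ (grι i 0 ≫ e) = (ρ_ _).inv := by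
      rw [← cancel_mono (grι i n ▷ 𝟙_ M), ← cancel_epi (grπ i n), Category.assoc,
        ← MonoidalCategory.tensorHom_def']
      have h3 : grι i n ⊗ₘ (grι i 0 ≫ e) = (grι i n ⊗ₘ grι i 0) ≫ _ ◁ e := by
        rw [← id_tensorHom, tensorHom_comp_tensorHom, Category.comp_id]
      have h4 := grπ_grComulDeg i n 0 n (add_zero n) =≫ (_ ◁ e)
      simp only [Category.assoc] at h4
      rw [h3, h4, ← id_tensorHom, tensorHom_comp_tensorHom, Category.comp_id, he,
        MonoidalCategory.tensorHom_def', ComonObj.comul_counit_assoc, ← rightUnitor_inv_naturality,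
        ← rightUnitor_inv_naturality, ← Category.assoc, ← Category.assoc, grπ_ι]
    rw [Category.assoc, h1, grComulPart_eq i (add_zero n), reassoc_of% h2,
      rightUnitor_inv_naturality]
  · rintro ⟨a, b⟩ hp hne
    rw [Finset.HasAntidiagonal.mem_antidiagonal] at hp
    obtain ⟨b, rfl⟩ : ∃ b', b = b' + 1 := Nat.exists_eq_succ_of_ne_zero (by
      rintro rfl
      exact hne (by simp_all))
    rw [Category.assoc, ← id_tensorHom, tensorHom_comp_tensorHom, ι_succ_grCounit]
    simp
  · intro h
    simp [Finset.HasAntidiagonal.mem_antidiagonal] at h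

lemma isGradedComul_grComul : IsGradedComul (grDeg i) (grComul i) := by
  refine ⟨fun n => ∑ p : Finset.HasAntidiagonal.antidiagonal n,
    grComulDeg i p.1.1 p.1.2 n (Finset.HasAntidiagonal.mem_antidiagonal.mp p.2) ≫
      Sigma.ι (fun p : Finset.HasAntidiagonal.antidiagonal n =>
        grDeg i p.1.1 ⊗ grDeg i p.1.2) p, fun n => ?_⟩
  rw [grComul, Sigma.ι_desc, Preadditive.sum_comp]
  refine Finset.sum_congr rfl fun p _ => ?_
  refine Eq.trans ?_ (Category.assoc _ _ _).symm
  exact congrArg (_ ≫ ·) (ι_tensorDegι _ _ n p).symm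

end GradedCoalgebra

/-! ### The associated graded object is an algebra -/

section GradedAlgebra

variable {M : Type u} [Category.{v} M] [Abelian M] [MonoidalCategory M] [CoabelianMonoidal M]

section

variable [HasColimits M] {B E : M} [ComonObj E] (i : B ⟶ E) [Mono i]

/-- The composite `B^(n+1) ⟶ gr^n ⟶ gr`. -/
noncomputable def toGr (n : ℕ) : (wedgePow i (n + 1) : M) ⟶ gr i :=
  grπ i n ≫ Sigma.ι (grDeg i) n

lemma toGr_zero_grCounit : toGr i 0 ≫ grCounit i = (wedgePow i 1).arrow ≫ ε[E] := by
  rw [toGr, Category.assoc, grπ_zero_grCounit]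

lemma toGr_grCounit_of_ne_zero {n : ℕ} (h : n ≠ 0) : toGr i n ≫ grCounit i = 0 := by
  obtain ⟨n, rfl⟩ := Nat.exists_eq_succ_of_ne_zero h
  rw [toGr, Category.assoc, ι_succ_grCounit, comp_zero]

variable [AbelianMonoidal M] [TensorCommutesWithDirectSums M]

/-- Direct sums commute with `⊗`, and `grπ ⊗ grπ` is epi by right exactness. Identities on `gr ⊗ gr`
thus reduce to identities on wedge powers. -/
lemma gr_tensor_hom_ext {Z : M} {f g : gr i ⊗ gr i ⟶ Z}
    (h : ∀ a b, (toGr i a ⊗ₘ toGr i b) ≫ f = (toGr i a ⊗ₘ toGr i b) ≫ g) : f = g := by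
  refine tensor_sigma_hom_ext fun a b => ?_
  rw [← cancel_epi (grπ i a ⊗ₘ grπ i b), tensorHom_comp_tensorHom_assoc,
    tensorHom_comp_tensorHom_assoc]
  exact h a b

lemma gr_tensor_tensor_hom_ext {Z : M} {f g : (gr i ⊗ gr i) ⊗ gr i ⟶ Z}
    (h : ∀ a b c, ((toGr i a ⊗ₘ toGr i b) ⊗ₘ toGr i c) ≫ f =
      ((toGr i a ⊗ₘ toGr i b) ⊗ₘ toGr i c) ≫ g) : f = g := by
  refine tensor_tensor_sigma_hom_ext fun a b c => ?_
  rw [← cancel_epi ((grπ i a ⊗ₘ grπ i b) ⊗ₘ grπ i c), tensorHom_comp_tensorHom_assoc,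
    tensorHom_comp_tensorHom_assoc, tensorHom_comp_tensorHom]
  exact h a b c

end

variable [BraidedCategory M]

section

variable {B E : M} [BimonObj B] [BimonObj E] (i : B ⟶ E) [Mono i] [IsBimonHom i]

section

variable [HasColimits M]

/-- The unit of `E`, as a morphism to the first wedge power. -/
noncomputable def wedgePowOne : 𝟙_ M ⟶ (wedgePow i 1 : M) := η[B] ≫ toWedgePowOne i

lemma wedgePowOne_arrow : wedgePowOne i ≫ (wedgePow i 1).arrow = η[E] := by
  rw [wedgePowOne, Category.assoc, toWedgePowOne_arrow, IsMonHom.one_hom]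

lemma wedgePowOne_arrow_assoc {Z : M} (f : E ⟶ Z) :
    wedgePowOne i ≫ (wedgePow i 1).arrow ≫ f = η[E] ≫ f := by
  rw [← Category.assoc, wedgePowOne_arrow]

/-- The unit of the associated graded bialgebra. -/
noncomputable def grOne : 𝟙_ M ⟶ gr i := wedgePowOne i ≫ toGr i 0

end

variable [AbelianMonoidal M]

/-- The restriction of the multiplication of `E` to the wedge filtration. -/
noncomputable def wedgePowMul (a b n : ℕ) (h : a + b = n) :
    (wedgePow i (a + 1) : M) ⊗ (wedgePow i (b + 1) : M) ⟶ (wedgePow i (n + 1) : M) :=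
  (exists_wedgePow_mul i a b n h).choose

lemma wedgePowMul_arrow (a b n : ℕ) (h : a + b = n) :
    wedgePowMul i a b n h ≫ (wedgePow i (n + 1)).arrow =
      ((wedgePow i (a + 1)).arrow ⊗ₘ (wedgePow i (b + 1)).arrow) ≫ μ[E] :=
  (exists_wedgePow_mul i a b n h).choose_spec

lemma wedgePowMul_arrow_assoc (a b n : ℕ) (h : a + b = n) {Z : M} (f : E ⟶ Z) :
    wedgePowMul i a b n h ≫ (wedgePow i (n + 1)).arrow ≫ f =
      ((wedgePow i (a + 1)).arrow ⊗ₘ (wedgePow i (b + 1)).arrow) ≫ μ[E] ≫ f := by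
  rw [← Category.assoc, wedgePowMul_arrow, Category.assoc]

/-- `B^a` has degree at most `a - 1`, which accounts for the shift by one; for `a = 0` or `b = 0`
the source is zero. -/
lemma wedgePow_tensor_mul_π {a b n : ℕ} (h : a + b ≤ n + 1) :
    ((wedgePow i a).arrow ⊗ₘ (wedgePow i b).arrow) ≫ μ[E] ≫ cokernel.π (wedgePow i n).arrow =
      0 := by
  have h0 : (wedgePow i 0).arrow = 0 := Subobject.bot_arrow
  rcases a with - | a
  · rw [h0]; simp
  rcases b with - | b
  · rw [h0]; simp
  rw [← Category.assoc, ← wedgePowMul_arrow i a b _ rfl, Category.assoc,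
    wedgePow_arrow_π i (by omega), comp_zero]

/-- The product descends to the quotients because `B^a · B^(b+1)` and `B^(a+1) · B^b` both lie in
`B^n`. -/
lemma exists_grMulDeg (a b n : ℕ) (h : a + b = n) :
    ∃ g : grDeg i a ⊗ grDeg i b ⟶ grDeg i n,
      (grπ i a ⊗ₘ grπ i b) ≫ g = wedgePowMul i a b n h ≫ grπ i n := by
  apply exists_desc_tensorHom
  · rw [← cancel_mono (grι i n), zero_comp, Category.assoc, Category.assoc, grπ_ι,
      wedgePowMul_arrow_assoc, ← tensorHom_id, tensorHom_comp_tensorHom_assoc,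
      Subobject.ofLE_arrow, Category.id_comp]
    exact wedgePow_tensor_mul_π i (by omega)
  · rw [← cancel_mono (grι i n), zero_comp, Category.assoc, Category.assoc, grπ_ι,
      wedgePowMul_arrow_assoc, ← id_tensorHom, tensorHom_comp_tensorHom_assoc,
      Subobject.ofLE_arrow, Category.id_comp]
    exact wedgePow_tensor_mul_π i (by omega)

/-- The component `gr^a ⊗ gr^b ⟶ gr^n`, for `a + b = n`, of the multiplication of the associated
graded bialgebra. -/
noncomputable def grMulDeg (a b n : ℕ) (h : a + b = n) : grDeg i a ⊗ grDeg i b ⟶ grDeg i n :=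
  (exists_grMulDeg i a b n h).choose

lemma grπ_grMulDeg (a b n : ℕ) (h : a + b = n) :
    (grπ i a ⊗ₘ grπ i b) ≫ grMulDeg i a b n h = wedgePowMul i a b n h ≫ grπ i n :=
  (exists_grMulDeg i a b n h).choose_spec

lemma wedgePowMul_assoc (a b c s t n : ℕ) (hs : a + b = s) (ht : b + c = t) (h : s + c = n)
    (h' : a + t = n) :
    wedgePowMul i a b s hs ▷ _ ≫ wedgePowMul i s c n h =
      (α_ _ _ _).hom ≫ _ ◁ wedgePowMul i b c t ht ≫ wedgePowMul i a t n h' := by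
  rw [← cancel_mono (wedgePow i (n + 1)).arrow]
  simp only [Category.assoc, wedgePowMul_arrow]
  rw [← tensorHom_id, tensorHom_comp_tensorHom_assoc, ← id_tensorHom,
    tensorHom_comp_tensorHom_assoc, wedgePowMul_arrow, wedgePowMul_arrow, Category.id_comp,
    Category.id_comp]
  have e1 : ((wedgePow i (a + 1)).arrow ⊗ₘ (wedgePow i (b + 1)).arrow) ≫ μ[E] ⊗ₘ
      (wedgePow i (c + 1)).arrow = (((wedgePow i (a + 1)).arrow ⊗ₘ (wedgePow i (b + 1)).arrow) ⊗ₘ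
        (wedgePow i (c + 1)).arrow) ≫ μ[E] ▷ E := by
    rw [← tensorHom_id, tensorHom_comp_tensorHom, Category.comp_id]
  have e2 : (wedgePow i (a + 1)).arrow ⊗ₘ ((wedgePow i (b + 1)).arrow ⊗ₘ
      (wedgePow i (c + 1)).arrow) ≫ μ[E] = ((wedgePow i (a + 1)).arrow ⊗ₘ
        (wedgePow i (b + 1)).arrow ⊗ₘ (wedgePow i (c + 1)).arrow) ≫ E ◁ μ[E] := by
    rw [← id_tensorHom, tensorHom_comp_tensorHom, Category.comp_id]
  rw [e1, e2, Category.assoc, Category.assoc, MonObj.mul_assoc, associator_naturality_assoc]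

variable [HasColimits M]

lemma wedgePowOne_mul (n : ℕ) :
    wedgePowOne i ▷ _ ≫ wedgePowMul i 0 n n (zero_add n) = (λ_ _).hom := by
  rw [← cancel_mono (wedgePow i (n + 1)).arrow, Category.assoc, wedgePowMul_arrow, ← tensorHom_id,
    tensorHom_comp_tensorHom_assoc, wedgePowOne_arrow, Category.id_comp,
    MonoidalCategory.tensorHom_def', Category.assoc, MonObj.one_mul, leftUnitor_naturality]

lemma wedgePowMul_one (n : ℕ) :
    _ ◁ wedgePowOne i ≫ wedgePowMul i n 0 n (add_zero n) = (ρ_ _).hom := by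
  rw [← cancel_mono (wedgePow i (n + 1)).arrow, Category.assoc, wedgePowMul_arrow, ← id_tensorHom,
    tensorHom_comp_tensorHom_assoc, wedgePowOne_arrow, Category.id_comp,
    MonoidalCategory.tensorHom_def, Category.assoc, MonObj.mul_one, rightUnitor_naturality]

end

section

variable [AbelianMonoidal M] [HasColimits M] {B E : M} [BimonObj B] [BimonObj E] (i : B ⟶ E)
  [Mono i] [IsBimonHom i]

variable [TensorCommutesWithDirectSums M]

lemma exists_grMul : ∃ m : gr i ⊗ gr i ⟶ gr i, ∀ a b,
    (Sigma.ι (grDeg i) a ⊗ₘ Sigma.ι (grDeg i) b) ≫ m =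
      grMulDeg i a b _ rfl ≫ Sigma.ι (grDeg i) (a + b) :=
  exists_tensor_sigma_desc _

/-- The multiplication of the associated graded bialgebra. -/
noncomputable def grMul : gr i ⊗ gr i ⟶ gr i := (exists_grMul i).choose

lemma ι_grMul (a b n : ℕ) (h : a + b = n) :
    (Sigma.ι (grDeg i) a ⊗ₘ Sigma.ι (grDeg i) b) ≫ grMul i =
      grMulDeg i a b n h ≫ Sigma.ι (grDeg i) n := by
  subst h
  exact (exists_grMul i).choose_spec a b

lemma toGr_grMul (a b n : ℕ) (h : a + b = n) :
    (toGr i a ⊗ₘ toGr i b) ≫ grMul i = wedgePowMul i a b n h ≫ toGr i n := by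
  rw [toGr, toGr, ← tensorHom_comp_tensorHom, Category.assoc, ι_grMul i a b n h, ← Category.assoc,
    grπ_grMulDeg, Category.assoc, toGr]

lemma toGr_grMul_assoc (a b n : ℕ) (h : a + b = n) {Z : M} (f : gr i ⟶ Z) :
    (toGr i a ⊗ₘ toGr i b) ≫ grMul i ≫ f = wedgePowMul i a b n h ≫ toGr i n ≫ f := by
  rw [← Category.assoc, toGr_grMul i a b n h, Category.assoc]

lemma isGradedMul_grMul : IsGradedMul (grDeg i) (grMul i) := by
  refine ⟨fun n => Sigma.desc fun p => grMulDeg i p.1.1 p.1.2 n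
    (Finset.HasAntidiagonal.mem_antidiagonal.mp p.2), fun n => ?_⟩
  refine Sigma.hom_ext _ _ fun p => ?_
  refine (Category.assoc _ _ _).symm.trans ?_
  refine (congrArg (· ≫ grMul i) (ι_tensorDegι _ _ n p)).trans ?_
  refine (ι_grMul i _ _ n (Finset.HasAntidiagonal.mem_antidiagonal.mp p.2)).trans ?_
  have h := Sigma.ι_desc (fun p : Finset.HasAntidiagonal.antidiagonal n =>
    grMulDeg i p.1.1 p.1.2 n (Finset.HasAntidiagonal.mem_antidiagonal.mp p.2)) p
  exact (congrArg (· ≫ Sigma.ι (grDeg i) n) h).symm.trans (Category.assoc _ _ _)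

lemma grOne_mul : grOne i ▷ gr i ≫ grMul i = (λ_ (gr i)).hom := by
  refine map_sigma_hom_ext (tensorLeft (𝟙_ M)) (grDeg i) fun n => ?_
  rw [← cancel_epi (𝟙_ M ◁ grπ i n)]
  have e : 𝟙_ M ◁ toGr i n ≫ grOne i ▷ gr i ≫ grMul i = 𝟙_ M ◁ toGr i n ≫ (λ_ (gr i)).hom := by
    have h : 𝟙_ M ◁ toGr i n ≫ grOne i ▷ gr i = wedgePowOne i ▷ _ ≫ (toGr i 0 ⊗ₘ toGr i n) := by
      rw [← MonoidalCategory.tensorHom_def', ← tensorHom_id, tensorHom_comp_tensorHom,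
        Category.id_comp, grOne]
    rw [reassoc_of% h, toGr_grMul i 0 n n (zero_add n), reassoc_of% (wedgePowOne_mul i n),
      leftUnitor_naturality]
  simpa [toGr] using e

lemma grMul_one : gr i ◁ grOne i ≫ grMul i = (ρ_ (gr i)).hom := by
  refine map_sigma_hom_ext (tensorRight (𝟙_ M)) (grDeg i) fun n => ?_
  rw [← cancel_epi (grπ i n ▷ 𝟙_ M)]
  have e : toGr i n ▷ 𝟙_ M ≫ gr i ◁ grOne i ≫ grMul i = toGr i n ▷ 𝟙_ M ≫ (ρ_ (gr i)).hom := by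
    have h : toGr i n ▷ 𝟙_ M ≫ gr i ◁ grOne i = _ ◁ wedgePowOne i ≫ (toGr i n ⊗ₘ toGr i 0) := by
      rw [← MonoidalCategory.tensorHom_def, ← id_tensorHom, tensorHom_comp_tensorHom,
        Category.id_comp, grOne]
    rw [reassoc_of% h, toGr_grMul i n 0 n (add_zero n), reassoc_of% (wedgePowMul_one i n),
      rightUnitor_naturality]
  simpa [toGr] using e

lemma grMul_assoc :
    grMul i ▷ gr i ≫ grMul i = (α_ _ _ _).hom ≫ gr i ◁ grMul i ≫ grMul i := by
  refine gr_tensor_tensor_hom_ext i fun a b c => ?_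
  have e1 : ((toGr i a ⊗ₘ toGr i b) ⊗ₘ toGr i c) ≫ grMul i ▷ gr i =
      wedgePowMul i a b _ rfl ▷ _ ≫ (toGr i (a + b) ⊗ₘ toGr i c) := by
    rw [← tensorHom_id, ← tensorHom_id, tensorHom_comp_tensorHom, tensorHom_comp_tensorHom,
      toGr_grMul i a b _ rfl, Category.id_comp, Category.comp_id]
  have e2 : (toGr i a ⊗ₘ (toGr i b ⊗ₘ toGr i c)) ≫ gr i ◁ grMul i =
      _ ◁ wedgePowMul i b c _ rfl ≫ (toGr i a ⊗ₘ toGr i (b + c)) := by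
    rw [← id_tensorHom, ← id_tensorHom, tensorHom_comp_tensorHom, tensorHom_comp_tensorHom,
      toGr_grMul i b c _ rfl, Category.id_comp, Category.comp_id]
  rw [reassoc_of% e1, associator_naturality_assoc, reassoc_of% e2, toGr_grMul i (a + b) c _ rfl,
    toGr_grMul i a (b + c) _ (add_assoc a b c).symm, ← Category.assoc,
    wedgePowMul_assoc i a b c (a + b) (b + c) _ rfl rfl rfl (add_assoc a b c).symm]
  simp only [Category.assoc]

end

end GradedAlgebra

/-! ### The associated graded object is a bialgebra -/

section GradedComul

variable {M : Type u} [Category.{v} M] [Abelian M] [MonoidalCategory M] [CoabelianMonoidal M]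
  [HasColimits M] {B E : M} [ComonObj E] (i : B ⟶ E) [Mono i] [ComonObj B] [IsComonHom i]

/-- If the comultiplication of an element `t` of `B^(n+1)` is a sum of elements of
`B^(a+1) ⊗ B^(b+1)` with `a + b = n`, then the comultiplication of the class of `t` in the
associated graded coalgebra is the sum of their classes. -/
lemma toGr_grComul_of_sum {n : ℕ} {T : M} (t : T ⟶ (wedgePow i (n + 1) : M)) {σ : Type*}
    (S : Finset σ) (d : σ → ℕ × ℕ) (hd : ∀ s ∈ S, (d s).1 + (d s).2 = n)
    (z : ∀ s, T ⟶ (wedgePow i ((d s).1 + 1) : M) ⊗ (wedgePow i ((d s).2 + 1) : M))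
    (ht : t ≫ (wedgePow i (n + 1)).arrow ≫ Δ[E] = ∑ s ∈ S,
      z s ≫ ((wedgePow i ((d s).1 + 1)).arrow ⊗ₘ (wedgePow i ((d s).2 + 1)).arrow)) :
    t ≫ toGr i n ≫ grComul i = ∑ s ∈ S, z s ≫ (toGr i (d s).1 ⊗ₘ toGr i (d s).2) := by
  -- The class of the term `z s`, placed in component `d s` and zero in the others.
  let c (s : σ) (p : ℕ × ℕ) : T ⟶ grDeg i p.1 ⊗ grDeg i p.2 :=
    (Pi.single (d s) (z s ≫ (grπ i (d s).1 ⊗ₘ grπ i (d s).2)) :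
      ∀ p : ℕ × ℕ, T ⟶ grDeg i p.1 ⊗ grDeg i p.2) p
  have hc0 (s : σ) (p : ℕ × ℕ) (h : p ≠ d s) : c s p = 0 := Pi.single_eq_of_ne h _
  have hc1 (s : σ) : c s (d s) = z s ≫ (grπ i (d s).1 ⊗ₘ grπ i (d s).2) := Pi.single_eq_same _ _
  have hcι (s : σ) (hs : s ∈ S) (p : ℕ × ℕ) (hp : p.1 + p.2 = n) :
      c s p ≫ (grι i p.1 ⊗ₘ grι i p.2) =
        z s ≫ ((wedgePow i ((d s).1 + 1)).arrow ⊗ₘ (wedgePow i ((d s).2 + 1)).arrow) ≫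
          (cokernel.π (wedgePow i p.1).arrow ⊗ₘ cokernel.π (wedgePow i p.2).arrow) := by
    -- Both pairs have sum `n`. If they differ, `p` exceeds `d s` in one coordinate, so `z s` dies
    -- in `E/B^p.1 ⊗ E/B^p.2`: component `p` sees only the terms of degree `p`.
    by_cases h : p = d s
    · subst h
      rw [hc1, Category.assoc, tensorHom_comp_tensorHom, tensorHom_comp_tensorHom, grπ_ι, grπ_ι]
    · have hs' := hd s hs
      have : ¬ (p.1 = (d s).1 ∧ p.2 = (d s).2) := fun h' => h (Prod.ext h'.1 h'.2)
      rw [hc0 s p h, zero_comp, wedgePow_arrow_tensor_π i (by omega), comp_zero]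
  have key (p : ℕ × ℕ) (hp : p.1 + p.2 = n) :
      t ≫ grπ i n ≫ grComulPart i n p = ∑ s ∈ S, c s p := by
    rw [← cancel_mono (grι i p.1 ⊗ₘ grι i p.2), Preadditive.sum_comp,
      Finset.sum_congr rfl fun s hs => hcι s hs p hp, grComulPart_eq i hp, Category.assoc,
      Category.assoc, grπ_grComulDeg, ← Category.assoc (wedgePow i (n + 1)).arrow, ← Category.assoc,
      ht, Preadditive.sum_comp]
    simp only [Category.assoc]
  rw [toGr, Category.assoc, ι_grComul, Preadditive.comp_sum, Preadditive.comp_sum]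
  have e : ∀ p ∈ Finset.HasAntidiagonal.antidiagonal n, t ≫ grπ i n ≫ grComulPart i n p ≫
      (Sigma.ι (grDeg i) p.1 ⊗ₘ Sigma.ι (grDeg i) p.2) =
      ∑ s ∈ S, c s p ≫ (Sigma.ι (grDeg i) p.1 ⊗ₘ Sigma.ι (grDeg i) p.2) := fun p hp => by
    have := key p (Finset.HasAntidiagonal.mem_antidiagonal.mp hp) =≫
      (Sigma.ι (grDeg i) p.1 ⊗ₘ Sigma.ι (grDeg i) p.2)
    rwa [Preadditive.sum_comp, Category.assoc, Category.assoc] at this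
  rw [Finset.sum_congr rfl e, Finset.sum_comm]
  refine Finset.sum_congr rfl fun s hs => ?_
  rw [Finset.sum_eq_single (d s)]
  · rw [hc1, Category.assoc, tensorHom_comp_tensorHom, toGr, toGr]
  · intro p _ hp
    rw [hc0 s p hp, zero_comp]
  · intro h
    exact absurd (Finset.HasAntidiagonal.mem_antidiagonal.mpr (hd s hs)) h

end GradedComul

section GradedBialgebra

variable {M : Type u} [Category.{v} M] [Abelian M] [MonoidalCategory M] [BraidedCategory M]
  [CoabelianMonoidal M] [HasColimits M]
  {B E : M} [BimonObj B] [BimonObj E] (i : B ⟶ E) [Mono i] [IsBimonHom i]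

lemma grOne_grCounit : grOne i ≫ grCounit i = 𝟙 _ := by
  rw [grOne, Category.assoc, toGr_zero_grCounit, wedgePowOne_arrow_assoc, BimonObj.one_counit]

lemma grOne_grComul : grOne i ≫ grComul i = (λ_ _).inv ≫ (grOne i ⊗ₘ grOne i) := by
  -- `Δ(1) = 1 ⊗ 1` is a decomposition with a single term, of degree `(0, 0)`.
  rw [grOne, Category.assoc, toGr_grComul_of_sum i (wedgePowOne i) (Finset.univ : Finset Unit)
    (fun _ => (0, 0)) (fun _ _ => rfl) (fun _ => (λ_ _).inv ≫ (wedgePowOne i ⊗ₘ wedgePowOne i))]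
  · simp
  · simp [wedgePowOne_arrow, wedgePowOne_arrow_assoc, MonObj.tensorObj.one_def]

variable [AbelianMonoidal M] [TensorCommutesWithDirectSums M]

lemma grMul_grCounit : grMul i ≫ grCounit i = (grCounit i ⊗ₘ grCounit i) ≫ (λ_ _).hom := by
  refine gr_tensor_hom_ext i fun a b => ?_
  rw [toGr_grMul_assoc i a b _ rfl, tensorHom_comp_tensorHom_assoc]
  rcases a with - | a
  · rcases b with - | b
    · rw [toGr_zero_grCounit, wedgePowMul_arrow_assoc, BimonObj.mul_counit,
        ← tensorHom_comp_tensorHom, Category.assoc]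
      simp
    · rw [toGr_grCounit_of_ne_zero i (show b + 1 ≠ 0 by omega),
        toGr_grCounit_of_ne_zero i (show 0 + (b + 1) ≠ 0 by omega)]
      simp
  · rw [toGr_grCounit_of_ne_zero i (show a + 1 ≠ 0 by omega),
      toGr_grCounit_of_ne_zero i (show a + 1 + b ≠ 0 by omega)]
    simp

/-- Decompositions of `Δ(x)` and `Δ(y)` multiply to one of `Δ(xy)`. Passing to classes in all three
gives the identity, up to the epimorphism `q ⊗ q'`. -/
lemma grMul_grComul :
    grMul i ≫ grComul i = (grComul i ⊗ₘ grComul i) ≫ tensorμ _ _ _ _ ≫ (grMul i ⊗ₘ grMul i) := by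
  refine gr_tensor_hom_ext i fun a b => ?_
  obtain ⟨T, q, hq, x, hx⟩ := exists_comul_isFilteredSum i a
  obtain ⟨T', q', hq', y, hy⟩ := exists_comul_isFilteredSum i b
  have ex := toGr_grComul_of_sum i q _ id
    (fun p hp => Finset.HasAntidiagonal.mem_antidiagonal.mp hp) x hx
  have ey := toGr_grComul_of_sum i q' _ id
    (fun p hp => Finset.HasAntidiagonal.mem_antidiagonal.mp hp) y hy
  have exy := toGr_grComul_of_sum i ((q ⊗ₘ q') ≫ wedgePowMul i a b _ rfl)
    (Finset.HasAntidiagonal.antidiagonal a ×ˢ Finset.HasAntidiagonal.antidiagonal b)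
    (fun s => (s.1.1 + s.2.1, s.1.2 + s.2.2))
    (fun s hs => by
      simp only [Finset.mem_product, Finset.HasAntidiagonal.mem_antidiagonal] at hs ⊢
      omega)
    (fun s => (x s.1 ⊗ₘ y s.2) ≫ tensorμ _ _ _ _ ≫
      (wedgePowMul i s.1.1 s.2.1 _ rfl ⊗ₘ wedgePowMul i s.1.2 s.2.2 _ rfl)) (by
      rw [Category.assoc, wedgePowMul_arrow_assoc, BimonObj.mul_comul,
        tensorHom_comp_tensorHom_assoc, tensorHom_comp_tensorHom_assoc, Category.assoc,
        Category.assoc, hx, hy, sum_tensor, Preadditive.sum_comp, Finset.sum_product]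
      refine Finset.sum_congr rfl fun p _ => ?_
      rw [tensor_sum, Preadditive.sum_comp]
      refine Finset.sum_congr rfl fun r _ => ?_
      simp only [Category.assoc]
      rw [tensorHom_comp_tensorHom, wedgePowMul_arrow, wedgePowMul_arrow,
        ← tensorHom_comp_tensorHom, ← tensorHom_comp_tensorHom, Category.assoc,
        tensorμ_natural_assoc])
  rw [← cancel_epi (q ⊗ₘ q'), toGr_grMul_assoc i a b _ rfl]
  simp only [Category.assoc] at exy
  rw [exy, tensorHom_comp_tensorHom_assoc, tensorHom_comp_tensorHom_assoc, Category.assoc,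
    Category.assoc, ex, ey, sum_tensor, Preadditive.sum_comp, Finset.sum_product]
  refine Finset.sum_congr rfl fun p _ => ?_
  rw [tensor_sum, Preadditive.sum_comp]
  refine Finset.sum_congr rfl fun r _ => ?_
  rw [tensorHom_comp_tensorHom, ← toGr_grMul i p.1 r.1 _ rfl, ← toGr_grMul i p.2 r.2 _ rfl,
    ← tensorHom_comp_tensorHom, ← tensorHom_comp_tensorHom, Category.assoc, tensorμ_natural_assoc]
  rfl

/-- The associated graded bialgebra. -/
@[reducible]
noncomputable def grBimonObj : BimonObj (gr i) where
  one := grOne i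
  mul := grMul i
  one_mul := grOne_mul i
  mul_one := grMul_one i
  mul_assoc := grMul_assoc i
  counit := grCounit i
  comul := grComul i
  counit_comul := grCounit_comul i
  comul_counit := grComul_counit i
  comul_assoc := grComul_coassoc i
  mul_comul := grMul_grComul i
  one_comul := grOne_grComul i
  mul_counit := grMul_grCounit i
  one_counit := grOne_grCounit i

end GradedBialgebra

/-! ### Uniqueness of the structure and the main theorem -/

lemma bimonObj_ext {M : Type u} [Category.{v} M] [MonoidalCategory M] [BraidedCategory M] {X : M}
    {S S' : BimonObj X} (hone : S.one = S'.one) (hmul : S.mul = S'.mul)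
    (hcounit : S.counit = S'.counit) (hcomul : S.comul = S'.comul) : S = S' := by
  rcases S with @⟨⟨one, mul⟩, ⟨counit, comul⟩⟩
  rcases S' with @⟨⟨one', mul'⟩, ⟨counit', comul'⟩⟩
  obtain rfl : one = one' := hone
  obtain rfl : mul = mul' := hmul
  obtain rfl : counit = counit' := hcounit
  obtain rfl : comul = comul' := hcomul
  rfl

theorem mainTheorem3 {M : Type u} [Category.{v} M] [Abelian M] [HasLimits M] [HasColimits M]
    [AB5 M] [MonoidalCategory M] [BraidedCategory M] [AbelianMonoidal M] [CoabelianMonoidal M]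
    [TensorCommutesWithDirectSums M] {B E : M} [BimonObj B] [BimonObj E]
    (i : B ⟶ E) [Mono i] [IsBimonHom i]
    (hsplit : ∀ (a b : ℕ) (h : a ≤ b), IsSplitMono (wedgePowIncl i h)) :
    -- the multiplication of `E` restricts to the wedge filtration
    ∃ mw : ∀ a b : ℕ, (wedgePow i (a + 1) : M) ⊗ (wedgePow i (b + 1) : M) ⟶
        (wedgePow i (a + b + 1) : M),
      (∀ a b : ℕ, mw a b ≫ (wedgePow i (a + b + 1)).arrow =
        ((wedgePow i (a + 1)).arrow ⊗ₘ (wedgePow i (b + 1)).arrow) ≫ μ[E]) ∧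
      -- and, with the induced multiplication and unit, the associated graded coalgebra is a
      -- graded braided bialgebra
      ∃! S : BimonObj (gr i),
        IsGradedBialgebra (grDeg i) S ∧
        S.comul = grComul i ∧
        S.counit = grCounit i ∧
        S.one = η[B] ≫ toWedgePowOne i ≫ grπ i 0 ≫ Sigma.ι (grDeg i) 0 ∧
        ∀ a b : ℕ,
          ((grπ i a ≫ Sigma.ι (grDeg i) a) ⊗ₘ (grπ i b ≫ Sigma.ι (grDeg i) b)) ≫ S.mul =
            mw a b ≫ grπ i (a + b) ≫ Sigma.ι (grDeg i) (a + b) := by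
  have hone : grOne i = η[B] ≫ toWedgePowOne i ≫ grπ i 0 ≫ Sigma.ι (grDeg i) 0 := by
    rw [grOne, wedgePowOne, Category.assoc, toGr]
  refine ⟨fun a b => wedgePowMul i a b _ rfl, fun a b => wedgePowMul_arrow i a b _ rfl,
    grBimonObj i, ⟨⟨isGradedMul_grMul i, isGradedComul_grComul i⟩, rfl, rfl, hone,
      fun a b => toGr_grMul i a b _ rfl⟩, ?_⟩
  rintro S ⟨-, hcomul, hcounit, hone', hmul⟩
  -- Unit and coalgebra are prescribed; the multiplication is determined by its values on the wedge
  -- powers.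
  refine bimonObj_ext (hone'.trans hone.symm) (gr_tensor_hom_ext i fun a b => ?_) hcounit hcomul
  exact (hmul a b).trans (toGr_grMul i a b _ rfl).symm
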